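/- **Proposition (Stability of piecewise-frozen endpoint bridges).** Let $S<T$ and $d\in\mathbb N$. Let $(h,Y)$ be a random pair (coarse history and latent volatility environment) with values in a product of two measurable spaces. Conditionally on $(h,Y)$ let $\sigma(t,h,Y)\in\mathbb R^{d\times d}$, $t\in[S,T]$, be a deterministic matrix function such that the entries of $a_t=\sigma\sigma^\top(t,h,Y)$ are integrable on $[S,T]$ almost surely, and put $$\Gamma_t=\int_S^t a_r\,dr,\qquad C=\Gamma_T .$$ Let $R^{h,Y}$, the ideal reference, be (a regular version of) the conditional law on $C([S,T];\mathbb R^d)$ of the Gaussian martingale $dZ_t=\sigma(t,h,Y)\,dW_t$, where $W$ is a Brownian motion independent of $Z_S$ and $Z_S$ has conditional law $m^{h,Y}$; that is, the increments of $Z$ are independent of the past and $Z_t-Z_s\sim N(0,\Gamma_t-\Gamma_s)$ for $s\le t$. For a finite grid $\mathcal P=\{S=s_0<\dots<s_M=T\}$ let $\Gamma^{\mathcal P}$ be the function that agrees with $\Gamma$ on $\mathcal P$ and is affine between consecutive grid points, and let $R^{h,Y,\mathcal P}$, the piecewise-frozen reference, be the law of the Gaussian martingale with the same initial law $m^{h,Y}$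 and with $\Gamma^{\mathcal P}$ in place of $\Gamma$. Let $\pi^{h,Y}$ be a conditional endpoint law on $\mathbb R^d\times\mathbb R^d$ which almost surely has finite relative entropy with respect to the law of $(Z_S,Z_T)$ under $R^{h,Y}$. The entropy projections $P^{h,Y,\star}$ and $P^{h,Y,\mathcal P,\star}$ are the minimisers of the relative entropy $H(\cdot\mid R^{h,Y})$, respectively $H(\cdot\mid R^{h,Y,\mathcal P})$, among all probability laws on $C([S,T];\mathbb R^d)$ under which the pair of endpoint values $(X_S,X_T)$ has law $\pi^{h,Y}$. Write $C^{+/2}$ for the positive semidefinite square root of the Moore–Penrose inverse of $C$, and $$r(h,Y;x,z)=\bigl|C^{+/2}(z-x)\bigr|,\qquad \eta_{\mathcal P}(h,Y)=\sup_{S\le t\le T}\bigl\|(\Gamma_t-\Gamma^{\mathcal P}_t)\,C^{+/2}\bigr\| .$$ Let $(\mathcal P_n)_{n}$ be a sequence of finite grids of $[S,T]$ such that $\eta_{\mathcal P_n}(h,Y)\to0$ in probability, and assume that $r$ is tight under the endpoint laws, that is, for every $\varepsilon>0$ there is $K$ with $\mathbb E\bigl[\pi^{h,Y}\{(x,z):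 r(h,Y;x,z)>K\}\bigr]\le\varepsilon$. Then, almost surely, the projections $P^{h,Y,\star}$ and $P^{h,Y,\mathcal P_n,\star}$ ($n\in\mathbb N$) exist and are unique, and $P^{h,Y,\mathcal P_n,\star}\to P^{h,Y,\star}$ in probability for the weak topology of probability measures on $C([S,T];\mathbb R^d)$, i.e. their Lévy–Prokhorov distance tends to $0$ in probability. -/

import Mathlib

open MeasureTheory ProbabilityTheory Filter Topology
open scoped ENNReal

namespace FrozenBridge

/-- Path space `C([S,T]; ℝ^d)` with the uniform metric. -/
abbrev PathSpace (S T : ℝ) (d : ℕ) : Type :=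
  C(Set.Icc S T, EuclideanSpace ℝ (Fin d))

/-- Path space carries its Borel σ-algebra. -/
instance instMeasurableSpacePath (S T : ℝ) (d : ℕ) : MeasurableSpace (PathSpace S T d) :=
  borel _

instance instBorelSpacePath (S T : ℝ) (d : ℕ) : BorelSpace (PathSpace S T d) :=
  ⟨rfl⟩

/-- The endpoint observation map `x ↦ (x_S, x_T)`. -/
def endpoints {S T : ℝ} {d : ℕ} (hST : S < T) (x : PathSpace S T d) :
    EuclideanSpace ℝ (Fin d) × EuclideanSpace ℝ (Fin d) :=
  (x ⟨S, Set.left_mem_Icc.2 hST.le⟩, x ⟨T, Set.right_mem_Icc.2 hST.le⟩)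

/-- The covariance cumulant `Γ_t = ∫_S^t a_r dr` (entrywise) of the covariance `a = σ σᵀ`. -/
noncomputable def cumulant {d : ℕ} (S : ℝ) (σ : ℝ → Matrix (Fin d) (Fin d) ℝ) (t : ℝ) :
    Matrix (Fin d) (Fin d) ℝ :=
  Matrix.of fun i j => ∫ r in S..t, (σ r * (σ r).transpose) i j

/-- A finite grid `S = s_0 < s_1 < ⋯ < s_M = T` (only `point 0, …, point M` matter). -/
structure SubGrid (S T : ℝ) where
  M : ℕ
  point : ℕ → ℝ
  lt_succ : ∀ k < M, point k < point (k + 1)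
  first : point 0 = S
  last : point M = T

namespace SubGrid

variable {S T : ℝ}

/-- The fraction of the `k`-th cell `[s_k, s_{k+1}]` lying to the left of `t`. -/
noncomputable def fraction (P : SubGrid S T) (k : ℕ) (t : ℝ) : ℝ :=
  max 0 (min 1 ((t - P.point k) / (P.point (k + 1) - P.point k)))

/-- The continuous function which agrees with `Γ` at the grid points and is affine on each cell of
the grid; see `interpolate_eq`. -/
noncomputable def interpolate {d : ℕ} (P : SubGrid S T) (Γ : ℝ → Matrix (Fin d) (Fin d) ℝ)
    (t : ℝ) : Matrix (Fin d) (Fin d) ℝ :=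
  Γ S + ∑ k ∈ Finset.range P.M, P.fraction k t • (Γ (P.point (k + 1)) - Γ (P.point k))

lemma point_mono (P : SubGrid S T) {i j : ℕ} (hij : i ≤ j) (hj : j ≤ P.M) :
    P.point i ≤ P.point j := by
  induction j, hij using Nat.le_induction with
  | base => exact le_rfl
  | succ n hn ih => exact (ih (by omega)).trans (P.lt_succ n (by omega)).le

/-- On the cell `[s_k, s_{k+1}]` the interpolation is the affine interpolation of `Γ`. -/
lemma interpolate_eq {d : ℕ} (P : SubGrid S T) (Γ : ℝ → Matrix (Fin d) (Fin d) ℝ) {k : ℕ}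
    (hk : k < P.M) {t : ℝ} (h₁ : P.point k ≤ t) (h₂ : t ≤ P.point (k + 1)) :
    P.interpolate Γ t = Γ (P.point k) +
      ((t - P.point k) / (P.point (k + 1) - P.point k)) •
        (Γ (P.point (k + 1)) - Γ (P.point k)) := by
  have hlow : ∀ j < k, P.fraction j t = 1 := by
    intro j hj
    have hpos := sub_pos.2 (P.lt_succ j (by omega))
    have hle : P.point (j + 1) ≤ t := (P.point_mono (by omega) hk.le).trans h₁
    have : 1 ≤ (t - P.point j) / (P.point (j + 1) - P.point j) := by
      rw [le_div_iff₀ hpos]; linarith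
    simp [fraction, min_eq_left this]
  have hmid : P.fraction k t = (t - P.point k) / (P.point (k + 1) - P.point k) := by
    have hpos := sub_pos.2 (P.lt_succ k hk)
    have a₁ : (t - P.point k) / (P.point (k + 1) - P.point k) ≤ 1 := by
      rw [div_le_one hpos]; linarith
    have a₂ : 0 ≤ (t - P.point k) / (P.point (k + 1) - P.point k) :=
      div_nonneg (by linarith) hpos.le
    rw [fraction, min_eq_right a₁, max_eq_right a₂]
  have hhigh : ∀ j, k + 1 ≤ j → j < P.M → P.fraction j t = 0 := by
    intro j hj hjM
    have hpos := sub_pos.2 (P.lt_succ j hjM)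
    have hle : t ≤ P.point j := h₂.trans (P.point_mono hj hjM.le)
    have : (t - P.point j) / (P.point (j + 1) - P.point j) ≤ 0 :=
      div_nonpos_of_nonpos_of_nonneg (by linarith) hpos.le
    rw [fraction, max_eq_left ((min_le_right _ _).trans this)]
  rw [interpolate, ← Finset.sum_range_add_sum_Ico _ (show k + 1 ≤ P.M from hk),
    Finset.sum_range_succ, hmid]
  have e₁ : ∑ j ∈ Finset.range k, P.fraction j t • (Γ (P.point (j + 1)) - Γ (P.point j))
      = Γ (P.point k) - Γ S := by
    have h := Finset.sum_range_sub (fun j => Γ (P.point j)) k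
    rw [P.first] at h
    rw [← h]
    refine Finset.sum_congr rfl fun j hj => ?_
    rw [hlow j (Finset.mem_range.1 hj), one_smul]
  have e₂ : ∑ j ∈ Finset.Ico (k + 1) P.M,
      P.fraction j t • (Γ (P.point (j + 1)) - Γ (P.point j)) = 0 := by
    refine Finset.sum_eq_zero fun j hj => ?_
    rw [Finset.mem_Ico] at hj
    rw [hhigh j hj.1 hj.2, zero_smul]
  rw [e₁, e₂]
  abel

end SubGrid

/-- `C^{+/2}`: the positive semidefinite square root of the Moore–Penrose inverse of a positive
semidefinite matrix `C` (the functional calculus sends `0 ↦ (√0)⁻¹ = 0`). -/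
noncomputable def pinvSqrt {d : ℕ} (C : Matrix (Fin d) (Fin d) ℝ) : Matrix (Fin d) (Fin d) ℝ :=
  cfc (fun x : ℝ => (Real.sqrt x)⁻¹) C

/-- The intrinsic endpoint norm `r(x,z) = |C^{+/2} (z - x)|` (Euclidean norm). -/
noncomputable def endpointNorm {d : ℕ} (C : Matrix (Fin d) (Fin d) ℝ)
    (p : EuclideanSpace ℝ (Fin d) × EuclideanSpace ℝ (Fin d)) : ℝ :=
  ‖Matrix.toEuclideanCLM (𝕜 := ℝ) (pinvSqrt C) (p.2 - p.1)‖

/-- The normalised cumulant interpolation error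
`η_P = sup_{S ≤ t ≤ T} ‖(Γ_t - Γ^P_t) C^{+/2}‖` with `C = Γ_T` (Euclidean operator norm). -/
noncomputable def interpolationError {d : ℕ} {S T : ℝ} (P : SubGrid S T)
    (Γ : ℝ → Matrix (Fin d) (Fin d) ℝ) : ℝ :=
  ⨆ t : Set.Icc S T,
    ‖Matrix.toEuclideanCLM (𝕜 := ℝ) ((Γ t - P.interpolate Γ t) * pinvSqrt (Γ T))‖

/-- `R` is the law on path space of the additive Gaussian martingale with initial law `m` and
(deterministic) covariance cumulant `Γ`, i.e. of `Z_t = Z_S + ∫_S^t σ_r dW_r` with `Z_S ∼ m`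
independent of `W` and `Γ_t = ∫_S^t σ_r σ_rᵀ dr`: increments are independent of the past, and the
increment over `[s,t]` is `N(0, Γ_t - Γ_s)`. These conditions determine `R` uniquely. -/
structure IsGaussianReference {d : ℕ} {S T : ℝ} (hST : S < T)
    (m : Measure (EuclideanSpace ℝ (Fin d))) (Γ : ℝ → Matrix (Fin d) (Fin d) ℝ)
    (R : Measure (PathSpace S T d)) : Prop where
  initial : R.map (fun x => (endpoints hST x).1) = m
  increment : ∀ s t : Set.Icc S T, s ≤ t →
    R.map (fun x => x t - x s) = multivariateGaussian 0 (Γ t - Γ s)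
  indep : ∀ s t : Set.Icc S T, s ≤ t →
    IndepFun (fun (x : PathSpace S T d) (u : Set.Iic s) => x u) (fun x => x t - x s) R

/-- `P` is a solution of the entropy projection problem: it minimises the relative entropy
`H(· | R)` among all path laws whose joint endpoint law is `π`. -/
def IsEntropyProjection {d : ℕ} {S T : ℝ} (hST : S < T) (R : Measure (PathSpace S T d))
    (π : Measure (EuclideanSpace ℝ (Fin d) × EuclideanSpace ℝ (Fin d)))
    (P : ProbabilityMeasure (PathSpace S T d)) : Prop :=
  (P : Measure (PathSpace S T d)).map (endpoints hST) = π ∧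
    ∀ P' : ProbabilityMeasure (PathSpace S T d),
      (P' : Measure (PathSpace S T d)).map (endpoints hST) = π →
        InformationTheory.klDiv (P : Measure (PathSpace S T d)) R ≤
          InformationTheory.klDiv (P' : Measure (PathSpace S T d)) R

/-- The entropy projection of `R` with endpoint law `π` (an arbitrary path law if the minimisation
problem has no solution). -/
noncomputable def entropyProjection {d : ℕ} {S T : ℝ} (hST : S < T)
    (R : Measure (PathSpace S T d))
    (π : Measure (EuclideanSpace ℝ (Fin d) × EuclideanSpace ℝ (Fin d))) :
    ProbabilityMeasure (PathSpace S T d) :=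
  Classical.epsilon (IsEntropyProjection hST R π)

end FrozenBridge

/-!
The argument separates a deterministic statement in one fixed environment from a passage to
convergence in probability.

*The projections are explicit.* Under a Gaussian reference with cumulant `Γ` and `C = Γ_T` the path
`x` is recovered from its endpoints and the residual bridge `x_t - x_S - Γ_t C⁺ (x_T - x_S)`. Since
`C C⁺ Γ_t = Γ_t`, the residual is uncorrelated with the total increment, hence, by Gaussianity,
independent of the endpoints (`IsGaussianReference.indepFun_endpoints_bridge`). Data processing for
the relative entropy and its strict convexity then show that the unique entropy projection is the
reference reweighted by the density of `π` with respect to the endpoint law, i.e. the law obtained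
by drawing endpoints from `π` and adding an independent residual bridge (`isEntropyProjection_iff`,
`IsGaussianReference.changeMarginal_eq`).

*Stability in a fixed environment.* The interpolated cumulants have the same terminal value `C`.
As `Γ_t` and its interpolation annihilate the kernel of `C`, the normalised error `η` controls both
the difference of the cumulants and the difference of the regression coefficients `Γ_t C⁺`
(`SubGrid.norm_sub_interpolate_le`, `SubGrid.norm_regression_sub_le`). Convergence of the cumulants
gives weak convergence of the centred references on path space (`tendsto_integral_centre`): along a
fixed grid the increments form a finite product of Gaussian laws, which depends continuously on the
covariances, and Lévy's maximal inequality bounds the oscillation within the cells by the sum of the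
squared variances of the increments, uniformly over the references. Exchanging the regression
coefficients costs at most their uniform distance times `|z - x - G_T|`, where the total increment
`G_T ∼ N(0, C)` has the same law under all references. Together this is
`tendsto_integral_changeMarginal`.

*Convergence in probability.* The density of the endpoint laws has a jointly measurable version, so
the projections agree almost surely with kernels, and the Lévy–Prokhorov distance of two kernels is
measurable because it is determined by countably many open sets
(`measurable_levyProkhorovEDist`). Every subsequence has a further one along which `η → 0` almost
surely, to which the result in a fixed environment applies.
-/

namespace FrozenBridge

open scoped NNReal RealInnerProductSpace

/-! ### Independence -/

section Independence

variable {Ω : Type*} {mΩ : MeasurableSpace Ω} {μ : Measure Ω}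

/-- A sequence of random variables, each independent of its predecessors, is independent. -/
lemma iIndepFun_of_indepFun_past {E : Type*} [MeasurableSpace E] [IsProbabilityMeasure μ]
    {Y : ℕ → Ω → E}
    (h : ∀ n, IndepFun (fun ω (j : Set.Iio n) => Y j ω) (Y n) μ) : iIndepFun Y μ := by
  rw [iIndepFun_iff_measure_inter_preimage_eq_mul]
  intro s
  induction s using Finset.induction_on_max with
  | empty => simp
  | insert n s hmax ih =>
    intro sets hsets
    have hn : n ∉ s := fun hn => lt_irrefl _ (hmax n hn)
    rw [Finset.set_biInter_insert, Finset.prod_insert hn,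
      ← ih fun i hi => hsets i (Finset.mem_insert_of_mem hi), Set.inter_comm, mul_comm]
    have hpre : (⋂ i ∈ s, Y i ⁻¹' sets i) = (fun ω (j : Set.Iio n) => Y j ω) ⁻¹'
        (⋂ i : s, (fun f : Set.Iio n → E => f ⟨i, hmax i i.2⟩) ⁻¹' sets i) := by
      ext ω; simp
    rw [hpre]
    refine (h n).measure_inter_preimage_eq_mul _ _ ?_ (hsets n (Finset.mem_insert_self _ _))
    exact MeasurableSet.iInter fun i =>
      (measurable_pi_apply _) (hsets i (Finset.mem_insert_of_mem i.2))

/-- If `X` is independent of `Y` and `Z` is independent of `(X, Y)`, then `X` is independent of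
`(Y, Z)`. -/
lemma _root_.ProbabilityTheory.IndepFun.prodMk_of_indepFun_prodMk {α β γ : Type*}
    [MeasurableSpace α] [MeasurableSpace β] [MeasurableSpace γ] [IsProbabilityMeasure μ]
    {X : Ω → α} {Y : Ω → β} {Z : Ω → γ}
    (hX : Measurable X) (hY : Measurable Y) (hZ : Measurable Z)
    (hXY : IndepFun X Y μ) (hXYZ : IndepFun (fun ω => (X ω, Y ω)) Z μ) :
    IndepFun X (fun ω => (Y ω, Z ω)) μ := by
  have := Measure.isProbabilityMeasure_map (μ := μ) hX.aemeasurable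
  have := Measure.isProbabilityMeasure_map (μ := μ) hY.aemeasurable
  have := Measure.isProbabilityMeasure_map (μ := μ) hZ.aemeasurable
  have hYZ : IndepFun Y Z μ := hXYZ.comp measurable_snd measurable_id
  rw [indepFun_iff_map_prod_eq_prod_map_map (by fun_prop) (by fun_prop)] at hXY hXYZ hYZ ⊢
  rw [hYZ, ← Measure.prodAssoc_prod, ← hXY, ← hXYZ, Measure.map_map (by fun_prop) (by fun_prop)]
  rfl

end Independence

/-! ### The Borel σ-algebra of a space of continuous functions -/

/-- The Borel σ-algebra of `C(K, E)` is generated by the evaluations. -/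
lemma measurable_continuousMap_iff {K E Ω : Type*} [TopologicalSpace K] [CompactSpace K]
    [SecondCountableTopology K] [R1Space K]
    [NormedAddCommGroup E] [SecondCountableTopology E] [MeasurableSpace E] [BorelSpace E]
    [MeasurableSpace C(K, E)] [BorelSpace C(K, E)] {m : MeasurableSpace Ω} {f : Ω → C(K, E)} :
    Measurable f ↔ ∀ t, Measurable fun ω => f ω t := by
  refine ⟨fun h t => (continuous_eval_const (F := C(K, E)) t).measurable.comp h, fun h => ?_⟩
  have hball : ∀ (g : C(K, E)) (r : ℝ), MeasurableSet (f ⁻¹' Metric.closedBall g r) := by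
    intro g r
    rcases lt_or_ge r 0 with hr | hr
    · simp [Metric.closedBall_eq_empty.2 hr]
    obtain ⟨D, hDc, hD⟩ := TopologicalSpace.exists_countable_dense K
    have : f ⁻¹' Metric.closedBall g r = ⋂ t ∈ D, {ω | dist (f ω t) (g t) ≤ r} := by
      ext ω
      simp only [Set.mem_preimage, Metric.mem_closedBall, ContinuousMap.dist_le hr,
        Set.mem_iInter, Set.mem_ofPred_eq]
      refine ⟨fun h t _ => h t, fun h t => ?_⟩
      have hcl : IsClosed {t | dist (f ω t) (g t) ≤ r} :=
        isClosed_le (by fun_prop) continuous_const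
      exact hcl.closure_subset_iff.2 (fun t ht => h t ht) (hD t)
    rw [this]
    exact MeasurableSet.biInter hDc fun t _ =>
      measurableSet_le ((h t).dist measurable_const) measurable_const
  refine measurable_of_isOpen fun U hU => ?_
  have hcov : ∃ c : Set (C(K, E) × ℚ), c.Countable ∧
      U = ⋃ p ∈ c, Metric.closedBall p.1 (p.2 : ℝ) := by
    obtain ⟨D, hDc, hD⟩ := TopologicalSpace.exists_countable_dense C(K, E)
    refine ⟨{p | p.1 ∈ D ∧ Metric.closedBall p.1 (p.2 : ℝ) ⊆ U},
      (hDc.prod (Set.to_countable Set.univ)).mono ?_, ?_⟩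
    · exact fun p hp => Set.mem_prod.2 ⟨hp.1, trivial⟩
    refine Set.Subset.antisymm (fun x hx => ?_) (Set.iUnion₂_subset fun p hp => hp.2)
    obtain ⟨ε, hε, hball⟩ := Metric.isOpen_iff.1 hU x hx
    obtain ⟨q, hq0, hq⟩ := exists_rat_btwn (half_pos hε)
    obtain ⟨y, hy, hxy⟩ := Metric.dense_iff.1 hD x q hq0
    refine Set.mem_iUnion₂.2 ⟨(y, q), ⟨hxy, fun z hz => hball ?_⟩, ?_⟩
    · have h₁ : dist z y ≤ q := hz
      have h₂ : dist y x < q := hy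
      have := dist_triangle z y x
      simp only [Metric.mem_ball]
      linarith
    · have h₂ : dist y x < q := hy
      rw [Metric.mem_closedBall, dist_comm]
      exact h₂.le
  obtain ⟨c, hc, rfl⟩ := hcov
  simp only [Set.preimage_iUnion]
  exact MeasurableSet.biUnion hc fun p _ => hball _ _

/-- A random element of `C(K, E)` is independent of a random variable as soon as its values,
regarded as a process, are. -/
lemma indepFun_continuousMap {K E Ω β : Type*} [TopologicalSpace K] [CompactSpace K]
    [SecondCountableTopology K] [R1Space K]
    [NormedAddCommGroup E] [SecondCountableTopology E] [MeasurableSpace E] [BorelSpace E]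
    [MeasurableSpace C(K, E)] [BorelSpace C(K, E)] {mΩ : MeasurableSpace Ω} {μ : Measure Ω}
    [MeasurableSpace β] {X : Ω → β} {f : Ω → C(K, E)}
    (h : IndepFun X (fun ω t => f ω t) μ) : IndepFun X f μ := by
  rw [IndepFun_iff_Indep] at h ⊢
  refine indep_of_indep_of_le_right h ?_
  have : @Measurable _ _ (MeasurableSpace.comap (fun ω t => f ω t) MeasurableSpace.pi) _ f := by
    refine (@measurable_continuousMap_iff K E Ω _ _ _ _ _ _ _ _ _ _ (_) f).2 fun t => ?_
    exact (measurable_pi_apply t).comp (comap_measurable _)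
  exact this.comap_le

/-! ### Measurability of the Lévy–Prokhorov distance of two kernels -/

/-- The Lévy–Prokhorov distance only has to be tested at rational levels and on finite unions of
sets of a countable basis. -/
lemma levyProkhorovEDist_le_iff {X : Type*} [MeasurableSpace X] [PseudoMetricSpace X]
    [BorelSpace X] {B : ℕ → Set X} (hB : TopologicalSpace.IsTopologicalBasis (Set.range B))
    (μ ν : Measure X) (c : ℝ≥0∞) :
    levyProkhorovEDist μ ν ≤ c ↔ ∀ q : ℚ, c < ENNReal.ofReal q → ∀ s : Finset ℕ,
      μ (⋃ i ∈ s, B i) ≤ ν (Metric.thickening q (⋃ i ∈ s, B i)) + ENNReal.ofReal q ∧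
      ν (⋃ i ∈ s, B i) ≤ μ (Metric.thickening q (⋃ i ∈ s, B i)) + ENNReal.ofReal q := by
  have hopen : ∀ s : Finset ℕ, IsOpen (⋃ i ∈ s, B i) := fun s =>
    isOpen_biUnion fun i _ => hB.isOpen (Set.mem_range_self i)
  constructor
  · intro h q hq s
    have hq0 : (0 : ℝ) ≤ q := by
      by_contra hneg
      rw [ENNReal.ofReal_of_nonpos (not_le.1 hneg).le] at hq
      exact not_lt_bot hq
    have hl := left_measure_le_of_levyProkhorovEDist_lt (h.trans_lt hq) (hopen s).measurableSet
    have hr := right_measure_le_of_levyProkhorovEDist_lt (h.trans_lt hq) (hopen s).measurableSet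
    rw [ENNReal.toReal_ofReal hq0] at hl hr
    exact ⟨hl, hr⟩
  · intro h
    -- An open set is the increasing union of the finite unions of basis sets contained in it.
    have key : ∀ (μ ν : Measure X) (ε : ℝ≥0∞) (A : Set X), c < ε → ε < ∞ →
        (∀ q : ℚ, c < ENNReal.ofReal q → ∀ s : Finset ℕ,
          μ (⋃ i ∈ s, B i) ≤ ν (Metric.thickening q (⋃ i ∈ s, B i)) + ENNReal.ofReal q) →
        μ A ≤ ν (Metric.thickening ε.toReal A) + ε := by
      intro μ ν ε A hcε hε hq
      obtain ⟨q, hq0, hcq, hqε⟩ := ENNReal.lt_iff_exists_rat_btwn.1 hcε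
      have hqlt : (q : ℝ) < ε.toReal := by
        have := (ENNReal.lt_ofReal_iff_toReal_lt (a := ENNReal.ofReal q)
          (b := ε.toReal) ENNReal.ofReal_ne_top).1 (by
            rw [ENNReal.ofReal_toReal hε.ne]; exact hqε)
        rwa [ENNReal.toReal_ofReal (by exact_mod_cast hq0)] at this
      set δ : ℝ := ε.toReal - q with hδ
      have hδ0 : 0 < δ := by linarith
      set U := Metric.thickening δ A with hU
      have hUo : IsOpen U := Metric.isOpen_thickening
      have hthick : Metric.thickening (q : ℝ) U ⊆ Metric.thickening ε.toReal A := by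
        have := Metric.thickening_thickening_subset (q : ℝ) δ A
        simpa [hδ] using this
      classical
      let s : ℕ → Finset ℕ := fun n => (Finset.range n).filter fun i => B i ⊆ U
      have hsub : ∀ n, (⋃ i ∈ s n, B i) ⊆ U := fun n => Set.iUnion₂_subset fun i hi =>
        (Finset.mem_filter.1 hi).2
      have hmono : Monotone fun n => ⋃ i ∈ s n, B i := fun m n hmn =>
        Set.biUnion_subset_biUnion_left fun i hi => by
          simp only [s, Finset.coe_filter, Finset.mem_range, Set.mem_ofPred_eq] at hi ⊢
          exact ⟨hi.1.trans_le hmn, hi.2⟩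
      have hUeq : U = ⋃ n, ⋃ i ∈ s n, B i := by
        refine Set.Subset.antisymm (fun x hx => ?_) (Set.iUnion_subset hsub)
        obtain ⟨_, ⟨i, rfl⟩, hxi, hiU⟩ := hB.exists_subset_of_mem_open hx hUo
        exact Set.mem_iUnion.2 ⟨i + 1, Set.mem_iUnion₂.2 ⟨i, by simp [s, hiU], hxi⟩⟩
      calc μ A ≤ μ U := measure_mono (Metric.self_subset_thickening hδ0 A)
        _ = ⨆ n, μ (⋃ i ∈ s n, B i) := by
          conv_lhs => rw [hUeq]
          exact hmono.measure_iUnion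
        _ ≤ ν (Metric.thickening ε.toReal A) + ε := by
          refine iSup_le fun n => (hq q hcq (s n)).trans (add_le_add (measure_mono ?_) hqε.le)
          exact (Metric.thickening_subset_of_subset _ (hsub n)).trans hthick
    refine levyProkhorovEDist_le_of_forall μ ν c fun ε A hcε hε _ => ⟨?_, ?_⟩
    · exact key μ ν ε A hcε hε fun q hq s => (h q hq s).1
    · exact key ν μ ε A hcε hε fun q hq s => (h q hq s).2

/-- The Lévy–Prokhorov distance of two kernels depends measurably on the parameter. -/
lemma measurable_levyProkhorovEDist {Y X : Type*} [MeasurableSpace Y] [MeasurableSpace X]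
    [PseudoMetricSpace X] [SecondCountableTopology X] [BorelSpace X] (κ η : Kernel Y X) :
    Measurable fun y => levyProkhorovEDist (κ y) (η y) := by
  obtain ⟨b, hbc, -, hb⟩ := TopologicalSpace.exists_countable_basis X
  obtain ⟨B, hB⟩ : ∃ B : ℕ → Set X, TopologicalSpace.IsTopologicalBasis (Set.range B) := by
    obtain ⟨B, hB⟩ := (hbc.insert ∅).exists_eq_range (Set.insert_nonempty _ _)
    exact ⟨B, hB ▸ hb.insert_empty⟩
  have hopen : ∀ s : Finset ℕ, IsOpen (⋃ i ∈ s, B i) := fun s =>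
    isOpen_biUnion fun i _ => hB.isOpen (Set.mem_range_self i)
  refine measurable_of_Iic fun c => ?_
  have : (fun y => levyProkhorovEDist (κ y) (η y)) ⁻¹' Set.Iic c =
      ⋂ q : ℚ, ⋂ _ : c < ENNReal.ofReal q, ⋂ s : Finset ℕ,
        ({y | κ y (⋃ i ∈ s, B i) ≤ η y (Metric.thickening q (⋃ i ∈ s, B i)) + ENNReal.ofReal q} ∩
        {y | η y (⋃ i ∈ s, B i) ≤ κ y (Metric.thickening q (⋃ i ∈ s, B i)) + ENNReal.ofReal q})
      := by
    ext y
    simp only [Set.mem_preimage, Set.mem_Iic, levyProkhorovEDist_le_iff hB, Set.mem_iInter,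
      Set.mem_inter_iff, Set.mem_ofPred_eq]
  rw [this]
  refine MeasurableSet.iInter fun q => MeasurableSet.iInter fun _ =>
    MeasurableSet.iInter fun s => ?_
  exact (measurableSet_le (κ.measurable_coe (hopen s).measurableSet)
      ((η.measurable_coe Metric.isOpen_thickening.measurableSet).add_const _)).inter
    (measurableSet_le (η.measurable_coe (hopen s).measurableSet)
      ((κ.measurable_coe Metric.isOpen_thickening.measurableSet).add_const _))

/-! ### Entropy minimisation under a marginal constraint -/

section Entropy

open InformationTheory

variable {X V W : Type*} [MeasurableSpace X] [MeasurableSpace V] [MeasurableSpace W]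

/-- Relative entropy is strictly convex in its first argument: two laws of the same finite entropy
coincide if their midpoint has no smaller entropy. -/
lemma eq_of_klDiv_le_klDiv_midpoint {R P P' M : Measure X} [IsProbabilityMeasure R]
    [IsProbabilityMeasure P] [IsProbabilityMeasure P'] [IsFiniteMeasure M]
    (hM : M = (2⁻¹ : ℝ≥0∞) • (P + P')) (hfin : klDiv P R ≠ ∞)
    (heq : klDiv P' R = klDiv P R) (hle : klDiv P R ≤ klDiv M R) : P = P' := by
  have hP : P ≪ R := (klDiv_ne_top_iff.1 hfin).1
  have hP' : P' ≪ R := (klDiv_ne_top_iff.1 (heq ▸ hfin)).1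
  have hMR : M ≪ R := by
    rw [hM]
    exact (Measure.AbsolutelyContinuous.add_left_iff.2 ⟨hP, hP'⟩).smul_left _
  have hMd : M.rnDeriv R =ᵐ[R] fun x => 2⁻¹ * (P.rnDeriv R x + P'.rnDeriv R x) := by
    have h₁ := Measure.rnDeriv_smul_left_of_ne_top (P + P') R (r := (2⁻¹ : ℝ≥0∞)) (by simp)
    have h₂ := Measure.rnDeriv_add P P' R
    rw [hM]
    filter_upwards [h₁, h₂] with x h₁ h₂
    rw [h₁, Pi.smul_apply, h₂, Pi.add_apply, smul_eq_mul]
  rw [klDiv_eq_lintegral_klFun_of_ac hP] at hfin heq hle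
  rw [klDiv_eq_lintegral_klFun_of_ac hP'] at heq
  rw [klDiv_eq_lintegral_klFun_of_ac hMR] at hle
  set a : X → ℝ := fun x => (P.rnDeriv R x).toReal with ha
  set b : X → ℝ := fun x => (P'.rnDeriv R x).toReal with hb
  have ha0 : ∀ x, 0 ≤ a x := fun x => ENNReal.toReal_nonneg
  have hb0 : ∀ x, 0 ≤ b x := fun x => ENNReal.toReal_nonneg
  have hMab : (fun x => (M.rnDeriv R x).toReal) =ᵐ[R] fun x => (1 / 2) * a x + (1 / 2) * b x := by
    filter_upwards [hMd, P.rnDeriv_lt_top R, P'.rnDeriv_lt_top R] with x hx h₁ h₂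
    rw [hx, ENNReal.toReal_mul, ENNReal.toReal_add h₁.ne h₂.ne]
    simp [ha, hb]
    ring
  have ham : Measurable a := (P.measurable_rnDeriv R).ennreal_toReal
  have hbm : Measurable b := (P'.measurable_rnDeriv R).ennreal_toReal
  set u : X → ℝ≥0∞ := fun x => ENNReal.ofReal (klFun (1 / 2 * a x + 1 / 2 * b x)) with hu
  set v : X → ℝ≥0∞ := fun x =>
    ENNReal.ofReal (1 / 2 * klFun (a x) + 1 / 2 * klFun (b x)) with hv
  have hum : Measurable u :=
    (measurable_klFun.comp ((ham.const_mul _).add (hbm.const_mul _))).ennreal_ofReal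
  have hconv : ∀ x, klFun (1 / 2 * a x + 1 / 2 * b x)
      ≤ 1 / 2 * klFun (a x) + 1 / 2 * klFun (b x) := fun x => by
    simpa using convexOn_klFun.2 (ha0 x) (hb0 x) (by norm_num : (0 : ℝ) ≤ 1 / 2)
      (by norm_num : (0 : ℝ) ≤ 1 / 2) (by norm_num)
  have huv : ∀ x, u x ≤ v x := fun x => ENNReal.ofReal_le_ofReal (hconv x)
  have hvint : ∫⁻ x, v x ∂(R) = ∫⁻ x, ENNReal.ofReal (klFun (a x)) ∂(R) := by
    have : ∀ x, v x = 2⁻¹ * ENNReal.ofReal (klFun (a x)) + 2⁻¹ * ENNReal.ofReal (klFun (b x)) := by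
      intro x
      have h2 : (2⁻¹ : ℝ≥0∞) = ENNReal.ofReal (1 / 2) := by
        rw [one_div, ENNReal.ofReal_inv_of_pos (by norm_num)]; simp
      have h₁ := klFun_nonneg (ha0 x)
      have h₂ := klFun_nonneg (hb0 x)
      rw [hv, h2, ← ENNReal.ofReal_mul (by norm_num), ← ENNReal.ofReal_mul (by norm_num),
        ← ENNReal.ofReal_add (by positivity) (by positivity)]
    simp_rw [this]
    rw [lintegral_add_left (by fun_prop), lintegral_const_mul _ (by fun_prop),
      lintegral_const_mul _ (by fun_prop), heq, ← add_mul, ENNReal.inv_two_add_inv_two, one_mul]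
  have huint : ∫⁻ x, ENNReal.ofReal (klFun (M.rnDeriv R x).toReal) ∂(R) = ∫⁻ x, u x ∂(R) := by
    refine lintegral_congr_ae ?_
    filter_upwards [hMab] with x hx
    rw [hx]
  have huv_ae : u =ᵐ[R] v := by
    refine ae_eq_of_ae_le_of_lintegral_le (ae_of_all _ huv) ?_ ?_ ?_
    · refine ne_top_of_le_ne_top ?_ (lintegral_mono huv)
      rw [hvint]; exact hfin
    · exact ((((measurable_klFun.comp ham).const_mul _).add
        ((measurable_klFun.comp hbm).const_mul _)).ennreal_ofReal).aemeasurable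
    · rw [hvint, ← huint]; exact hle
  have hab : P.rnDeriv R =ᵐ[R] P'.rnDeriv R := by
    filter_upwards [huv_ae, P.rnDeriv_lt_top R, P'.rnDeriv_lt_top R] with x hx h₁ h₂
    rw [← ENNReal.toReal_eq_toReal_iff' h₁.ne h₂.ne]
    by_contra hne
    have hlt := strictConvexOn_klFun.2 (ha0 x) (hb0 x) hne (by norm_num : (0 : ℝ) < 1 / 2)
      (by norm_num : (0 : ℝ) < 1 / 2) (by norm_num)
    simp only [smul_eq_mul] at hlt
    have h0 : 0 ≤ klFun (1 / 2 * a x + 1 / 2 * b x) :=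
      klFun_nonneg (by have := ha0 x; have := hb0 x; positivity)
    exact absurd hx ((ENNReal.ofReal_lt_ofReal_iff (h0.trans_lt hlt)).2 hlt).ne
  rw [← Measure.withDensity_rnDeriv_eq P R hP, ← Measure.withDensity_rnDeriv_eq P' R hP',
    withDensity_congr_ae hab]

/-- The law obtained from `R` by changing the law of the statistic `e` into `π` while keeping the
conditional law given `e`. -/
noncomputable def changeMarginal (R : Measure X) (e : X → V) (π : Measure V) : Measure X :=
  R.withDensity fun x => π.rnDeriv (R.map e) (e x)

lemma map_withDensity_comp {R : Measure X} {g : X → V} (hg : Measurable g) {f : V → ℝ≥0∞}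
    (hf : Measurable f) :
    (R.withDensity fun x => f (g x)).map g = (R.map g).withDensity f := by
  ext s hs
  rw [Measure.map_apply hg hs, withDensity_apply _ (hg hs), withDensity_apply _ hs,
    setLIntegral_map hs hf hg]

lemma map_changeMarginal {R : Measure X} [IsProbabilityMeasure R] {e : X → V} (he : Measurable e)
    {π : Measure V} [IsProbabilityMeasure π] (hπ : π ≪ R.map e) :
    (changeMarginal R e π).map e = π := by
  have := Measure.isProbabilityMeasure_map (μ := R) he.aemeasurable
  rw [changeMarginal, map_withDensity_comp he (Measure.measurable_rnDeriv _ _),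
    Measure.withDensity_rnDeriv_eq _ _ hπ]

lemma isProbabilityMeasure_changeMarginal {R : Measure X} [IsProbabilityMeasure R] {e : X → V}
    (he : Measurable e) {π : Measure V} [IsProbabilityMeasure π] (hπ : π ≪ R.map e) :
    IsProbabilityMeasure (changeMarginal R e π) := by
  refine ⟨?_⟩
  have h := map_changeMarginal he hπ
  rw [← Set.preimage_univ (f := e), ← Measure.map_apply he MeasurableSet.univ, h, measure_univ]

variable {R : Measure X} [IsProbabilityMeasure R] {e : X → V} {β : X → W} {Ψ : V × W → X}

/-- If `x` is recovered by `Ψ` from `e x` and an independent residual `β x`, then changing the law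
of `e` amounts to feeding `Ψ` with the new marginal and the old residual. -/
lemma changeMarginal_eq_map (he : Measurable e) (hβ : Measurable β) (hΨ : Measurable Ψ)
    (hind : IndepFun e β R) (hrec : ∀ x, Ψ (e x, β x) = x)
    {π : Measure V} [IsProbabilityMeasure π] (hπ : π ≪ R.map e) :
    changeMarginal R e π = (π.prod (R.map β)).map Ψ := by
  have := Measure.isProbabilityMeasure_map (μ := R) he.aemeasurable
  have := Measure.isProbabilityMeasure_map (μ := R) hβ.aemeasurable
  have hmeas := Measure.measurable_rnDeriv π (R.map e)
  have h₁ : (changeMarginal R e π).map (fun x => (e x, β x)) = π.prod (R.map β) := by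
    have := map_withDensity_comp (R := R) (g := fun x => (e x, β x)) (he.prodMk hβ)
      (f := fun p => π.rnDeriv (R.map e) p.1) (by fun_prop)
    rw [changeMarginal, this, (indepFun_iff_map_prod_eq_prod_map_map he.aemeasurable
      hβ.aemeasurable).1 hind, ← prod_withDensity_left hmeas, Measure.withDensity_rnDeriv_eq _ _ hπ]
  rw [← h₁, Measure.map_map hΨ (he.prodMk hβ)]
  have : Ψ ∘ (fun x => (e x, β x)) = id := funext hrec
  rw [this, Measure.map_id]

/-- Changing the marginal along independent residuals costs exactly the relative entropy of the
marginals. -/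
lemma klDiv_changeMarginal_le (he : Measurable e) (hβ : Measurable β) (hΨ : Measurable Ψ)
    (hind : IndepFun e β R) (hrec : ∀ x, Ψ (e x, β x) = x)
    {π : Measure V} [IsProbabilityMeasure π] (hπ : π ≪ R.map e) :
    klDiv (changeMarginal R e π) R ≤ klDiv π (R.map e) := by
  have := Measure.isProbabilityMeasure_map (μ := R) he.aemeasurable
  have := Measure.isProbabilityMeasure_map (μ := R) hβ.aemeasurable
  have hR : R = ((R.map e).prod (R.map β)).map Ψ := by
    rw [← (indepFun_iff_map_prod_eq_prod_map_map he.aemeasurable hβ.aemeasurable).1 hind,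
      Measure.map_map hΨ (he.prodMk hβ)]
    have : Ψ ∘ (fun x => (e x, β x)) = id := funext hrec
    rw [this, Measure.map_id]
  calc klDiv (changeMarginal R e π) R
      = klDiv ((π.prod (R.map β)).map Ψ) (((R.map e).prod (R.map β)).map Ψ) := by
        rw [← hR, changeMarginal_eq_map he hβ hΨ hind hrec hπ]
    _ ≤ klDiv (π.prod (R.map β)) ((R.map e).prod (R.map β)) := klDiv_map_le _ _ hΨ
    _ = klDiv π (R.map e) := by
        rw [← Measure.compProd_const, ← Measure.compProd_const, klDiv_compProd_left]

end Entropy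

/-- The entropy projection exists and is unique, and it is obtained from the reference by changing
the endpoint law, provided that paths are recovered from their endpoints and an independent
residual. -/
lemma isEntropyProjection_iff {d : ℕ} {S T : ℝ} (hST : S < T) {W : Type*} [MeasurableSpace W]
    {R : Measure (PathSpace S T d)} [IsProbabilityMeasure R]
    (he : Measurable (endpoints (d := d) hST))
    {β : PathSpace S T d → W}
    {Ψ : (EuclideanSpace ℝ (Fin d) × EuclideanSpace ℝ (Fin d)) × W → PathSpace S T d}
    (hβ : Measurable β) (hΨ : Measurable Ψ) (hind : IndepFun (endpoints hST) β R)
    (hrec : ∀ x, Ψ (endpoints hST x, β x) = x)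
    {π : Measure (EuclideanSpace ℝ (Fin d) × EuclideanSpace ℝ (Fin d))} [IsProbabilityMeasure π]
    (hent : InformationTheory.klDiv π (R.map (endpoints hST)) ≠ ∞)
    (A : ProbabilityMeasure (PathSpace S T d)) :
    IsEntropyProjection hST R π A ↔
      (A : Measure (PathSpace S T d)) = changeMarginal R (endpoints hST) π := by
  have hac : π ≪ R.map (endpoints hST) := (InformationTheory.klDiv_ne_top_iff.1 hent).1
  have := Measure.isProbabilityMeasure_map (μ := R) he.aemeasurable
  have hprob := isProbabilityMeasure_changeMarginal he hac
  have hlow : ∀ P' : ProbabilityMeasure (PathSpace S T d),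
      (P' : Measure (PathSpace S T d)).map (endpoints hST) = π →
      InformationTheory.klDiv (changeMarginal R (endpoints hST) π) R ≤
        InformationTheory.klDiv (P' : Measure (PathSpace S T d)) R := by
    intro P' hP'
    refine (klDiv_changeMarginal_le he hβ hΨ hind hrec hac).trans ?_
    conv_lhs => rw [← hP']
    exact InformationTheory.klDiv_map_le _ _ he
  have hmarg := map_changeMarginal he hac
  constructor
  · rintro ⟨hA, hmin⟩
    have hle := hmin ⟨_, hprob⟩ hmarg
    have hge := hlow A hA
    have hfin : InformationTheory.klDiv (changeMarginal R (endpoints hST) π) R ≠ ∞ :=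
      ne_top_of_le_ne_top hent (klDiv_changeMarginal_le he hβ hΨ hind hrec hac)
    have hM : IsProbabilityMeasure ((2⁻¹ : ℝ≥0∞) •
        ((changeMarginal R (endpoints hST) π) + (A : Measure (PathSpace S T d)))) := by
      refine ⟨?_⟩
      rw [Measure.smul_apply, Measure.add_apply, measure_univ, measure_univ, smul_eq_mul,
        one_add_one_eq_two, ENNReal.inv_mul_cancel (by simp) (by simp)]
    refine (eq_of_klDiv_le_klDiv_midpoint rfl hfin (le_antisymm hle hge) ?_).symm
    refine hlow ⟨_, hM⟩ ?_
    rw [ProbabilityMeasure.coe_mk, Measure.map_smul, Measure.map_add _ _ he, hA, hmarg,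
      ← two_smul ℝ≥0∞ π, smul_smul, ENNReal.inv_mul_cancel (by simp) (by simp), one_smul]
  · intro hA
    refine ⟨by rw [hA, hmarg], fun P' hP' => ?_⟩
    rw [hA]
    exact hlow P' hP'

/-! ### Covariance cumulants -/

/-- A covariance cumulant on `[S,T]`: a continuous matrix function starting at `0` whose increments
are positive semidefinite. -/
structure IsCumulant {d : ℕ} (S T : ℝ) (Γ : ℝ → Matrix (Fin d) (Fin d) ℝ) : Prop where
  zero : Γ S = 0
  posSemidef : ∀ {s t : ℝ}, s ∈ Set.Icc S T → t ∈ Set.Icc S T → s ≤ t → (Γ t - Γ s).PosSemidef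
  continuousOn : ContinuousOn Γ (Set.Icc S T)

section Cumulants

variable {d : ℕ} {S T : ℝ}

lemma isCumulant_cumulant (hST : S < T) {σ : ℝ → Matrix (Fin d) (Fin d) ℝ}
    (hσ : ∀ i j, IntervalIntegrable (fun t => (σ t * (σ t).transpose) i j) volume S T) :
    IsCumulant S T (cumulant S σ) where
  zero := by ext i j; simp [cumulant]
  posSemidef := by
    intro s t hs ht hst
    have hint : ∀ i j, ∀ {u v : ℝ}, u ∈ Set.Icc S T → v ∈ Set.Icc S T →
        IntervalIntegrable (fun r => (σ r * (σ r).transpose) i j) volume u v :=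
      fun i j u v hu hv => (hσ i j).mono_set (by
        rw [Set.uIcc_of_le hST.le]
        exact Set.uIcc_subset_Icc hu hv)
    have hS : S ∈ Set.Icc S T := Set.left_mem_Icc.2 hST.le
    have hsub : ∀ i j, (cumulant S σ t - cumulant S σ s) i j =
        ∫ r in s..t, (σ r * (σ r).transpose) i j := by
      intro i j
      simp only [cumulant, Matrix.sub_apply, Matrix.of_apply]
      exact intervalIntegral.integral_interval_sub_left (hint i j hS ht) (hint i j hS hs)
    refine Matrix.PosSemidef.of_dotProduct_mulVec_nonneg ?_ fun x => ?_
    · ext i j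
      rw [Matrix.conjTranspose_apply, hsub, hsub, star_trivial]
      refine intervalIntegral.integral_congr fun r _ => ?_
      simp [Matrix.mul_apply, mul_comm]
    · have hx : star x ⬝ᵥ (cumulant S σ t - cumulant S σ s).mulVec x =
          ∫ r in s..t, star x ⬝ᵥ (σ r * (σ r).transpose).mulVec x := by
        simp only [dotProduct, Matrix.mulVec, hsub, Finset.mul_sum]
        rw [intervalIntegral.integral_finsetSum]
        · refine Finset.sum_congr rfl fun i _ => ?_
          rw [intervalIntegral.integral_finsetSum]
          · refine Finset.sum_congr rfl fun j _ => ?_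
            rw [intervalIntegral.integral_const_mul, intervalIntegral.integral_mul_const]
          · exact fun j _ => ((hint i j hs ht).mul_const _).const_mul _
        · intro i _
          have := IntervalIntegrable.sum (μ := volume) (a := s) (b := t) Finset.univ
            (f := fun j r => star x i * ((σ r * (σ r).transpose) i j * x j))
            fun j _ => ((hint i j hs ht).mul_const _).const_mul _
          simpa only [Finset.sum_fn] using this
      rw [hx]
      refine intervalIntegral.integral_nonneg hst fun r _ => ?_
      have := Matrix.posSemidef_self_mul_conjTranspose (σ r)
      rw [Matrix.conjTranspose_eq_transpose_of_trivial] at this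
      exact this.dotProduct_mulVec_nonneg x
  continuousOn := by
    refine continuousOn_pi.2 fun i => continuousOn_pi.2 fun j => ?_
    have h := intervalIntegral.continuousOn_primitive_interval' (hσ i j) Set.left_mem_uIcc
    rwa [Set.uIcc_of_le hST.le] at h

namespace SubGrid

lemma M_pos (P : SubGrid S T) (hST : S < T) : 0 < P.M := by
  rcases Nat.eq_zero_or_pos P.M with h | h
  · have h₁ := P.first
    have h₂ := P.last
    rw [h] at h₂
    linarith
  · exact h

lemma fraction_mono (P : SubGrid S T) {k : ℕ} (hk : k < P.M) : Monotone (P.fraction k) := by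
  intro s t hst
  have hpos := sub_pos.2 (P.lt_succ k hk)
  unfold fraction
  gcongr

lemma continuous_fraction (P : SubGrid S T) (k : ℕ) : Continuous (P.fraction k) := by
  unfold fraction
  fun_prop

lemma point_mem (P : SubGrid S T) {k : ℕ} (hk : k ≤ P.M) : P.point k ∈ Set.Icc S T := by
  constructor
  · exact P.first.symm.le.trans (P.point_mono (Nat.zero_le _) hk)
  · exact (P.point_mono hk le_rfl).trans P.last.le

lemma interpolate_left (P : SubGrid S T) (hST : S < T) (Γ : ℝ → Matrix (Fin d) (Fin d) ℝ) :
    P.interpolate Γ S = Γ S := by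
  have h := P.interpolate_eq Γ (P.M_pos hST) (t := S) P.first.le
    ((P.point_mem (P.M_pos hST)).1)
  rw [h, P.first]
  simp

lemma interpolate_right (P : SubGrid S T) (hST : S < T) (Γ : ℝ → Matrix (Fin d) (Fin d) ℝ) :
    P.interpolate Γ T = Γ T := by
  have hM := P.M_pos hST
  have hM' : P.M - 1 + 1 = P.M := by omega
  have h := P.interpolate_eq Γ (show P.M - 1 < P.M by omega) (t := T)
    ((P.point_mem (by omega)).2) (by rw [hM', P.last])
  have hlt := P.lt_succ (P.M - 1) (by omega)
  rw [hM', P.last] at h hlt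
  rw [h, div_self (sub_pos.2 hlt).ne']
  simp

lemma isCumulant_interpolate (P : SubGrid S T) (hST : S < T) {Γ : ℝ → Matrix (Fin d) (Fin d) ℝ}
    (hΓ : IsCumulant S T Γ) : IsCumulant S T (P.interpolate Γ) where
  zero := by rw [P.interpolate_left hST, hΓ.zero]
  posSemidef := by
    intro s t _ _ hst
    have : P.interpolate Γ t - P.interpolate Γ s = ∑ k ∈ Finset.range P.M,
        (P.fraction k t - P.fraction k s) • (Γ (P.point (k + 1)) - Γ (P.point k)) := by
      simp only [interpolate, sub_smul, Finset.sum_sub_distrib]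
      abel
    rw [this]
    refine Matrix.posSemidef_sum _ fun k hk => ?_
    have hk := Finset.mem_range.1 hk
    exact (hΓ.posSemidef (P.point_mem hk.le) (P.point_mem hk) (P.lt_succ k hk).le).smul
      (sub_nonneg.2 (P.fraction_mono hk hst))
  continuousOn := by
    refine Continuous.continuousOn ?_
    unfold interpolate
    exact continuous_const.add (continuous_finsetSum _ fun k _ =>
      (P.continuous_fraction k).smul continuous_const)

end SubGrid

/-- The Moore–Penrose inverse of a positive semidefinite matrix. -/
noncomputable def pinv (C : Matrix (Fin d) (Fin d) ℝ) : Matrix (Fin d) (Fin d) ℝ :=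
  pinvSqrt C * pinvSqrt C

lemma mul_pinv_mul_self {C : Matrix (Fin d) (Fin d) ℝ} (hC : C.PosSemidef) :
    C * (pinv C * C) = C := by
  have hsa : IsSelfAdjoint C := hC.1
  have hfin : ∀ f : ℝ → ℝ, ContinuousOn f (spectrum ℝ C) := fun f =>
    (Matrix.finite_real_spectrum (A := C)).continuousOn f
  have hnn : ∀ x ∈ spectrum ℝ C, 0 ≤ x := fun x hx => by
    have := (Matrix.posSemidef_iff_isHermitian_and_spectrum_nonneg.1 hC).2 hx
    simpa using this
  set g : ℝ → ℝ := fun x => (Real.sqrt x)⁻¹ with hg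
  calc C * (cfc g C * cfc g C * C)
      = cfc (fun x : ℝ => x) C * (cfc g C * cfc g C * cfc (fun x : ℝ => x) C) := by
        rw [cfc_id' ℝ C]
    _ = cfc (fun x => x * (g x * g x * x)) C := by
        rw [← cfc_mul _ _ C (hfin _) (hfin _), ← cfc_mul _ _ C (hfin _) (hfin _),
          ← cfc_mul _ _ C (hfin _) (hfin _)]
    _ = cfc (fun x : ℝ => x) C := by
        refine cfc_congr fun x hx => ?_
        rcases (hnn x hx).eq_or_lt with h | h
        · simp [← h]
        · have h₁ := Real.mul_self_sqrt h.le
          have h₂ := (Real.sqrt_pos.2 h).ne'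
          simp only [hg]
          field_simp
          nlinarith
    _ = C := cfc_id' ℝ C

/-- The kernel of `C` is contained in the kernel of every matrix `0 ≤ M ≤ C`, whence
`M C⁺ C = M`. -/
lemma mul_pinv_mul_of_le {C M : Matrix (Fin d) (Fin d) ℝ} (hM : M.PosSemidef)
    (hMC : (C - M).PosSemidef) : M * (pinv C * C) = M := by
  have hC : C.PosSemidef := by simpa using hMC.add hM
  set Q := 1 - pinv C * C with hQ
  have hCQ : C * Q = 0 := by rw [hQ, mul_sub, mul_pinv_mul_self hC, mul_one, sub_self]
  suffices h : M * Q = 0 by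
    rw [hQ, mul_sub, mul_one, sub_eq_zero] at h
    exact h.symm
  -- `M` vanishes on each column `q` of `Q`, since `0 ≤ ⟨q, M q⟩ ≤ ⟨q, C q⟩ = 0`.
  ext i j
  have hv : C.mulVec (fun k => Q k j) = 0 := by
    ext k
    exact congrFun (congrFun hCQ k) j
  have h₁ := hM.dotProduct_mulVec_nonneg (fun k => Q k j)
  have h₂ := hMC.dotProduct_mulVec_nonneg (fun k => Q k j)
  rw [Matrix.sub_mulVec, hv, dotProduct_sub, dotProduct_zero, zero_sub] at h₂
  have h₃ := (hM.dotProduct_mulVec_zero_iff (fun k => Q k j)).1 (le_antisymm (by linarith) h₁)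
  exact congrFun h₃ i

lemma IsCumulant.mul_pinv_mul {Γ : ℝ → Matrix (Fin d) (Fin d) ℝ} (hΓ : IsCumulant S T Γ)
    {t : ℝ} (ht : t ∈ Set.Icc S T) : Γ t * (pinv (Γ T) * Γ T) = Γ t := by
  have hST : S ≤ T := ht.1.trans ht.2
  refine mul_pinv_mul_of_le ?_ (hΓ.posSemidef ht (Set.right_mem_Icc.2 hST) ht.2)
  have := hΓ.posSemidef (Set.left_mem_Icc.2 hST) ht ht.1
  rwa [hΓ.zero, sub_zero] at this

lemma norm_le_interpolationError (hST : S < T) (P : SubGrid S T)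
    {Γ : ℝ → Matrix (Fin d) (Fin d) ℝ} (hΓ : IsCumulant S T Γ) {t : ℝ} (ht : t ∈ Set.Icc S T) :
    ‖Matrix.toEuclideanCLM (𝕜 := ℝ) ((Γ t - P.interpolate Γ t) * pinvSqrt (Γ T))‖ ≤
      interpolationError P Γ := by
  have hcont : ContinuousOn (fun t => ‖Matrix.toEuclideanCLM (𝕜 := ℝ)
      ((Γ t - P.interpolate Γ t) * pinvSqrt (Γ T))‖) (Set.Icc S T) := by
    have h₁ : Continuous (Matrix.toEuclideanCLM (n := Fin d) (𝕜 := ℝ)) :=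
      LinearMap.continuous_of_finiteDimensional
        (Matrix.toEuclideanCLM (n := Fin d) (𝕜 := ℝ)).toAlgEquiv.toLinearMap
    have h₂ := (P.isCumulant_interpolate hST hΓ).continuousOn
    have h₃ := hΓ.continuousOn
    exact continuous_norm.comp_continuousOn
      (h₁.comp_continuousOn ((h₃.sub h₂).mul continuousOn_const))
  refine le_ciSup (f := fun t : Set.Icc S T => ‖Matrix.toEuclideanCLM (𝕜 := ℝ)
    ((Γ t - P.interpolate Γ t) * pinvSqrt (Γ T))‖) ?_ ⟨t, ht⟩
  have := isCompact_Icc.bddAbove_image hcont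
  rwa [Set.image_eq_range] at this

end Cumulants

/-! ### Paths, endpoints and residuals -/

section Paths

variable {d : ℕ} {S T : ℝ}

/-- The initial time, as a point of `[S,T]`. -/
def startTime (hST : S < T) : Set.Icc S T := ⟨S, Set.left_mem_Icc.2 hST.le⟩

/-- The terminal time, as a point of `[S,T]`. -/
def endTime (hST : S < T) : Set.Icc S T := ⟨T, Set.right_mem_Icc.2 hST.le⟩

lemma startTime_le (hST : S < T) (t : Set.Icc S T) : startTime hST ≤ t := t.2.1

lemma le_endTime (hST : S < T) (t : Set.Icc S T) : t ≤ endTime hST := t.2.2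

/-- The path started at the origin with the same increments as `x`. -/
def centre (hST : S < T) (x : PathSpace S T d) : PathSpace S T d :=
  x - ContinuousMap.const _ (x (startTime hST))

@[simp] lemma centre_apply (hST : S < T) (x : PathSpace S T d) (t : Set.Icc S T) :
    centre hST x t = x t - x (startTime hST) := rfl

/-- The path `t ↦ A_t v` of a continuous family of linear maps. -/
noncomputable def drift
    (A : C(Set.Icc S T, EuclideanSpace ℝ (Fin d) →L[ℝ] EuclideanSpace ℝ (Fin d)))
    (v : EuclideanSpace ℝ (Fin d)) : PathSpace S T d :=
  ⟨fun t => A t v, by fun_prop⟩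

@[simp] lemma drift_apply
    (A : C(Set.Icc S T, EuclideanSpace ℝ (Fin d) →L[ℝ] EuclideanSpace ℝ (Fin d)))
    (v : EuclideanSpace ℝ (Fin d)) (t : Set.Icc S T) : drift A v t = A t v := rfl

/-- The residual of a path started at the origin after subtraction of `A_t` applied to its final
value. -/
noncomputable def bridge (hST : S < T)
    (A : C(Set.Icc S T, EuclideanSpace ℝ (Fin d) →L[ℝ] EuclideanSpace ℝ (Fin d)))
    (g : PathSpace S T d) : PathSpace S T d :=
  g - drift A (g (endTime hST))

/-- The path with residual `b` and endpoints `p`. -/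
noncomputable def assemble
    (A : C(Set.Icc S T, EuclideanSpace ℝ (Fin d) →L[ℝ] EuclideanSpace ℝ (Fin d)))
    (q : (EuclideanSpace ℝ (Fin d) × EuclideanSpace ℝ (Fin d)) × PathSpace S T d) :
    PathSpace S T d :=
  ContinuousMap.const _ q.1.1 + drift A (q.1.2 - q.1.1) + q.2

variable (A : C(Set.Icc S T, EuclideanSpace ℝ (Fin d) →L[ℝ] EuclideanSpace ℝ (Fin d)))

lemma continuous_drift : Continuous (drift A) :=
  ContinuousMap.continuous_of_continuous_uncurry _ (by
    change Continuous fun p : EuclideanSpace ℝ (Fin d) × Set.Icc S T => A p.2 p.1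
    fun_prop)

lemma continuous_centre (hST : S < T) : Continuous (centre (d := d) hST) := by
  unfold centre
  exact continuous_id.sub (ContinuousMap.continuous_const'.comp (continuous_eval_const _))

lemma continuous_bridge (hST : S < T) : Continuous (bridge hST A) := by
  unfold bridge
  exact continuous_id.sub ((continuous_drift A).comp (continuous_eval_const _))

lemma continuous_assemble : Continuous (assemble A) := by
  unfold assemble
  exact ((ContinuousMap.continuous_const'.comp (by fun_prop)).add
    ((continuous_drift A).comp (by fun_prop))).add continuous_snd

lemma continuous_endpoints (hST : S < T) : Continuous (endpoints (d := d) hST) :=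
  (continuous_eval_const _).prodMk (continuous_eval_const _)

lemma assemble_endpoints (hST : S < T) (x : PathSpace S T d) :
    assemble A (endpoints hST x, bridge hST A (centre hST x)) = x := by
  ext1 t
  simp only [assemble, endpoints, bridge, ContinuousMap.add_apply, ContinuousMap.const_apply,
    drift_apply, ContinuousMap.sub_apply, centre_apply, startTime, endTime]
  abel

end Paths

/-! ### The Gaussian reference -/

section Reference

variable {d : ℕ} {S T : ℝ} {hST : S < T} {m : Measure (EuclideanSpace ℝ (Fin d))}
  {Γ : ℝ → Matrix (Fin d) (Fin d) ℝ} {R : Measure (PathSpace S T d)}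

lemma measurable_eval (t : Set.Icc S T) : Measurable fun x : PathSpace S T d => x t :=
  (continuous_eval_const t).measurable

/-- The starting point of a path followed by its increments along a sequence of times. -/
noncomputable def startAndIncrements (t : ℕ → Set.Icc S T) :
    ℕ → PathSpace S T d → EuclideanSpace ℝ (Fin d)
  | 0, x => x (t 0)
  | k + 1, x => x (t (k + 1)) - x (t k)

lemma measurable_startAndIncrements (t : ℕ → Set.Icc S T) (n : ℕ) :
    Measurable (startAndIncrements (d := d) t n) := by
  cases n with
  | zero => exact measurable_eval _
  | succ n => exact (measurable_eval _).sub (measurable_eval _)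

lemma IsGaussianReference.map_centre_apply (hR : IsGaussianReference hST m Γ R)
    (hΓ : IsCumulant S T Γ) (t : Set.Icc S T) :
    R.map (fun x => centre hST x t) = multivariateGaussian 0 (Γ t) := by
  have h := hR.increment (startTime hST) t (startTime_le hST t)
  have h0 : Γ (startTime hST) = 0 := hΓ.zero
  rw [h0, sub_zero] at h
  exact h

lemma IsCumulant.posSemidef_apply (hΓ : IsCumulant S T Γ) (t : Set.Icc S T) :
    (Γ t).PosSemidef := by
  have := hΓ.posSemidef (Set.left_mem_Icc.2 (t.2.1.trans t.2.2)) t.2 t.2.1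
  rwa [hΓ.zero, sub_zero] at this

variable [IsProbabilityMeasure R]

/-- The starting point and the successive increments along a monotone sequence of times are
independent. -/
lemma IsGaussianReference.iIndepFun_increments (hR : IsGaussianReference hST m Γ R)
    {t : ℕ → Set.Icc S T} (ht : Monotone t) :
    iIndepFun (startAndIncrements t) R := by
  refine iIndepFun_of_indepFun_past fun n => ?_
  cases n with
  | zero =>
    have : IsEmpty (Set.Iio 0) := ⟨fun j => Nat.not_lt_zero _ j.2⟩
    have hconst : (fun (x : PathSpace S T d) (j : Set.Iio 0) => startAndIncrements t j x) =
        fun _ => fun j => isEmptyElim j := by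
      ext x j
      exact isEmptyElim j
    rw [hconst]
    exact indepFun_const_left _ _
  | succ n =>
    have h := hR.indep (t n) (t (n + 1)) (ht n.le_succ)
    let φ : (Set.Iic (t n) → EuclideanSpace ℝ (Fin d)) →
        (Set.Iio (n + 1) → EuclideanSpace ℝ (Fin d)) := fun f j =>
      match j with
      | ⟨0, _⟩ => f ⟨t 0, ht (Nat.zero_le _)⟩
      | ⟨k + 1, hk⟩ => f ⟨t (k + 1), ht (Nat.lt_succ_iff.1 hk)⟩ -
          f ⟨t k, ht (by have := Set.mem_Iio.1 hk; omega)⟩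
    have hφ : Measurable φ := by
      refine measurable_pi_lambda _ fun j => ?_
      obtain ⟨j, hj⟩ := j
      cases j with
      | zero => exact measurable_pi_apply _
      | succ k => exact (measurable_pi_apply _).sub (measurable_pi_apply _)
    have h' := h.comp hφ measurable_id
    convert h' using 1
    · ext1 x
      ext1 j
      obtain ⟨j, hj⟩ := j
      cases j with
      | zero => rfl
      | succ k => rfl
    · rfl

lemma IsGaussianReference.hasIndepIncrements (hR : IsGaussianReference hST m Γ R) :
    HasIndepIncrements (fun t (x : PathSpace S T d) => centre hST x t) R := by
  refine HasIndepIncrements.of_nat fun t ht _ => ?_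
  have h := (hR.iIndepFun_increments ht).precomp (g := Nat.succ) Nat.succ_injective
  convert h using 3 with i x
  simp [startAndIncrements]

/-- The starting point is independent of the increments. -/
lemma IsGaussianReference.indepFun_start_centre (hR : IsGaussianReference hST m Γ R) :
    IndepFun (fun x : PathSpace S T d => x (startTime hST)) (centre hST) R := by
  refine indepFun_continuousMap (IndepFun.indepFun_process (measurable_eval _)
    (fun t => (measurable_eval t).comp (continuous_centre hST).measurable) fun I => ?_)
  classical
  -- Enumerate `I ∪ {S}` by an eventually constant monotone sequence.
  set J : Finset (Set.Icc S T) := insert (startTime hST) I with hJ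
  have hJ0 : 0 < J.card := Finset.card_pos.2 (Finset.insert_nonempty _ _)
  set t : ℕ → Set.Icc S T := fun k => J.orderEmbOfFin rfl ⟨min k (J.card - 1), by omega⟩ with ht
  have hmono : Monotone t := fun a b hab =>
    (J.orderEmbOfFin rfl).monotone (by simp only [Fin.mk_le_mk]; omega)
  have ht0 : t 0 = startTime hST := by
    refine le_antisymm ?_ (startTime_le hST _)
    have h₁ := Finset.orderEmbOfFin_zero (s := J) rfl hJ0
    have h₂ : t 0 = J.orderEmbOfFin rfl ⟨0, hJ0⟩ := by simp [ht]
    rw [h₂, h₁]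
    exact Finset.min'_le _ _ (Finset.mem_insert_self _ _)
  have hsurj : ∀ i : I, ∃ k < J.card, t k = i := by
    intro i
    have hi : (i : Set.Icc S T) ∈ Set.range (J.orderEmbOfFin rfl) := by
      rw [Finset.range_orderEmbOfFin]
      exact Finset.mem_coe.2 (Finset.mem_insert_of_mem i.2)
    obtain ⟨k, hk⟩ := hi
    refine ⟨k, k.2, ?_⟩
    rw [← hk]
    simp only [ht]
    congr 1
    ext
    have := k.2
    simp only
    omega
  choose k hk htk using hsurj
  have hind := (hR.iIndepFun_increments hmono).indepFun_finset {0}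
    ((Finset.range J.card).image Nat.succ) (by simp) (measurable_startAndIncrements t)
  let φ : (((Finset.range J.card).image Nat.succ : Finset ℕ) → EuclideanSpace ℝ (Fin d)) →
      (I → EuclideanSpace ℝ (Fin d)) := fun f i =>
    ∑ j : Fin (k i), f ⟨j + 1, by
      refine Finset.mem_image_of_mem _ (Finset.mem_range.2 ?_)
      exact j.2.trans (hk i)⟩
  have hφ : Measurable φ := by
    refine measurable_pi_lambda _ fun i => ?_
    exact Finset.measurable_sum _ fun j _ => measurable_pi_apply _
  let ψ : (({0} : Finset ℕ) → EuclideanSpace ℝ (Fin d)) → EuclideanSpace ℝ (Fin d) := fun f =>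
    f ⟨0, Finset.mem_singleton_self 0⟩
  have hψ : Measurable ψ := measurable_pi_apply _
  have hcomp := hind.comp hψ hφ
  have e₁ : (ψ ∘ fun (x : PathSpace S T d) (i : ({0} : Finset ℕ)) => startAndIncrements t i x) =
      fun x => x (startTime hST) := by
    ext1 x
    simp only [Function.comp_apply, ψ, startAndIncrements]
    rw [← ht0]
  have e₂ : (φ ∘ fun (x : PathSpace S T d)
      (i : ((Finset.range J.card).image Nat.succ : Finset ℕ)) => startAndIncrements t i x) =
      fun x (i : I) => centre hST x i := by
    ext1 x
    ext1 i
    simp only [Function.comp_apply, φ, startAndIncrements]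
    rw [Fin.sum_univ_eq_sum_range (fun j => x (t (j + 1)) - x (t j)) (k i),
      Finset.sum_range_sub (fun j => x (t j)), htk i, ht0, centre_apply]
  rw [e₁, e₂] at hcomp
  exact hcomp

/-- The joint law of the endpoints depends on the initial law and the total covariance only. -/
lemma IsGaussianReference.map_endpoints (hR : IsGaussianReference hST m Γ R)
    (hΓ : IsCumulant S T Γ) :
    R.map (endpoints hST) =
      (m.prod (multivariateGaussian 0 (Γ T))).map (fun p => (p.1, p.1 + p.2)) := by
  have hc : Measurable fun x : PathSpace S T d => centre hST x (endTime hST) :=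
    (measurable_eval _).comp (continuous_centre hST).measurable
  have hind : IndepFun (fun x : PathSpace S T d => x (startTime hST))
      (fun x => centre hST x (endTime hST)) R :=
    hR.indepFun_start_centre.comp measurable_id (measurable_eval (endTime hST))
  have h := (indepFun_iff_map_prod_eq_prod_map_map (measurable_eval _).aemeasurable
    hc.aemeasurable).1 hind
  have h₁ : R.map (fun x : PathSpace S T d => x (startTime hST)) = m := hR.initial
  rw [h₁, hR.map_centre_apply hΓ] at h
  change _ = m.prod (multivariateGaussian 0 (Γ T)) at h
  rw [← h, Measure.map_map (by fun_prop) ((measurable_eval _).prodMk hc)]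
  congr 1
  ext1 x
  simp [endpoints, startTime, endTime]

lemma IsGaussianReference.isGaussianProcess (hR : IsGaussianReference hST m Γ R)
    (hΓ : IsCumulant S T Γ) :
    IsGaussianProcess (fun t (x : PathSpace S T d) => centre hST x t) R := by
  have : Fact (S ≤ T) := ⟨hST.le⟩
  refine HasIndepIncrements.isGaussianProcess (fun t => ⟨?_⟩) ?_ hR.hasIndepIncrements
  · rw [hR.map_centre_apply hΓ]
    infer_instance
  · refine ae_of_all _ fun x => ?_
    rw [centre_apply, sub_eq_zero]
    rfl

/-- `Cov(⟨u, G_T⟩, ⟨v, G_t⟩) = ⟨u, Γ_t v⟩` for the increments `G` from the initial time. -/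
lemma IsGaussianReference.covariance_centre (hR : IsGaussianReference hST m Γ R)
    (hΓ : IsCumulant S T Γ) (t : Set.Icc S T) (u v : EuclideanSpace ℝ (Fin d)) :
    cov[fun x => ⟪u, centre hST x (endTime hST)⟫, fun x => ⟪v, centre hST x t⟫; R] =
      ⟪u, Matrix.toEuclideanCLM (𝕜 := ℝ) (Γ t) v⟫ := by
  have hG := hR.isGaussianProcess hΓ
  have hmeas : ∀ s : Set.Icc S T, Measurable fun x : PathSpace S T d => centre hST x s := fun s =>
    (measurable_eval _).comp (continuous_centre hST).measurable
  have hmem : ∀ (s : Set.Icc S T) (w : EuclideanSpace ℝ (Fin d)),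
      MemLp (fun x : PathSpace S T d => ⟪w, centre hST x s⟫) 2 R := fun s w =>
    ((hG.hasGaussianLaw_eval s).map (innerSL ℝ w)).memLp_two
  have hdiag : cov[fun x => ⟪u, centre hST x t⟫, fun x => ⟪v, centre hST x t⟫; R] =
      ⟪u, Matrix.toEuclideanCLM (𝕜 := ℝ) (Γ t) v⟫ := by
    have h := covarianceBilin_multivariateGaussian (μ := 0) (hΓ.posSemidef_apply t) u v
    rw [← hR.map_centre_apply hΓ t, covarianceBilin_apply_eq_cov, covariance_map] at h
    · simp only [Function.comp_def] at h
      rw [h, Matrix.inner_toEuclideanCLM]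
    all_goals first
      | exact (hmeas t).aemeasurable
      | (rw [hR.map_centre_apply hΓ t]; exact IsGaussian.memLp_two_id)
      | exact Measurable.aestronglyMeasurable (by fun_prop)
  have hind : IndepFun (fun x : PathSpace S T d => x (endTime hST) - x t)
      (fun x => centre hST x t) R := by
    have h := hR.indep t (endTime hST) (le_endTime hST t)
    let φ : (Set.Iic t → EuclideanSpace ℝ (Fin d)) → EuclideanSpace ℝ (Fin d) := fun f =>
      f ⟨t, Set.self_mem_Iic⟩ - f ⟨startTime hST, startTime_le hST t⟩
    have hφ : Measurable φ := (measurable_pi_apply _).sub (measurable_pi_apply _)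
    exact (h.comp hφ measurable_id).symm
  have hincr : cov[fun x : PathSpace S T d => ⟪u, x (endTime hST) - x t⟫,
      fun x => ⟪v, centre hST x t⟫; R] = 0 := by
    refine (hind.comp (φ := fun w => ⟪u, w⟫) (ψ := fun w => ⟪v, w⟫) (by fun_prop)
      (by fun_prop)).covariance_eq_zero ?_ (hmem t v)
    have := (hmem (endTime hST) u).sub (hmem t u)
    convert this using 1
    ext x
    simp only [Function.comp_apply, Pi.sub_apply, ← inner_sub_right, centre_apply]
    congr 1
    abel
  have hsplit : (fun x : PathSpace S T d => ⟪u, centre hST x (endTime hST)⟫) =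
      (fun x => ⟪u, centre hST x t⟫) + fun x => ⟪u, x (endTime hST) - x t⟫ := by
    ext x
    simp only [Pi.add_apply, ← inner_add_right, centre_apply]
    congr 1
    abel
  rw [hsplit, covariance_add_left (hmem t u) ?_ (hmem t v), hdiag, hincr, add_zero]
  have := (hmem (endTime hST) u).sub (hmem t u)
  convert this using 1
  ext x
  simp only [Pi.sub_apply, ← inner_sub_right, centre_apply]
  congr 1
  abel

/-- The regression coefficients `Γ_t C⁺` of the increment up to time `t` on the total increment. -/
noncomputable def IsCumulant.regression (hΓ : IsCumulant S T Γ) :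
    C(Set.Icc S T, EuclideanSpace ℝ (Fin d) →L[ℝ] EuclideanSpace ℝ (Fin d)) :=
  ⟨fun t => Matrix.toEuclideanCLM (𝕜 := ℝ) (Γ t * pinv (Γ T)), by
    have h₁ : Continuous (Matrix.toEuclideanCLM (n := Fin d) (𝕜 := ℝ)) :=
      LinearMap.continuous_of_finiteDimensional
        (Matrix.toEuclideanCLM (n := Fin d) (𝕜 := ℝ)).toAlgEquiv.toLinearMap
    exact h₁.comp ((continuousOn_iff_continuous_domRestrict.1 hΓ.continuousOn).mul
      continuous_const)⟩

lemma IsCumulant.regression_apply (hΓ : IsCumulant S T Γ) (t : Set.Icc S T) :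
    hΓ.regression t = Matrix.toEuclideanCLM (𝕜 := ℝ) (Γ t * pinv (Γ T)) := rfl

/-- The residual of the regression is uncorrelated with the total increment:
`C (Γ_t C⁺)ᵀ = Γ_t`. -/
lemma IsCumulant.mul_transpose_regression (hΓ : IsCumulant S T Γ) (t : Set.Icc S T) :
    Γ T * (Γ t * pinv (Γ T)).transpose = Γ t := by
  have hsym : ∀ s : Set.Icc S T, (Γ s).transpose = Γ s := fun s => by
    have := (hΓ.posSemidef_apply s).1
    rwa [Matrix.IsHermitian, Matrix.conjTranspose_eq_transpose_of_trivial] at this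
  have hT : (Γ T).transpose = Γ T := hsym ⟨T, Set.right_mem_Icc.2 (t.2.1.trans t.2.2)⟩
  have h := congrArg Matrix.transpose (hΓ.mul_pinv_mul t.2)
  rw [← mul_assoc, Matrix.transpose_mul, hT, hsym t] at h
  exact h

/-- Under the Gaussian reference the endpoints are independent of the residual bridge. -/
lemma IsGaussianReference.indepFun_endpoints_bridge (hR : IsGaussianReference hST m Γ R)
    (hΓ : IsCumulant S T Γ) :
    IndepFun (endpoints hST) (fun x => bridge hST hΓ.regression (centre hST x)) R := by
  have hG := hR.isGaussianProcess hΓ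
  have hmeas : ∀ s : Set.Icc S T, Measurable fun x : PathSpace S T d => centre hST x s := fun s =>
    (measurable_eval _).comp (continuous_centre hST).measurable
  have hβ : Measurable fun x : PathSpace S T d => bridge hST hΓ.regression (centre hST x) :=
    ((continuous_bridge _ hST).comp (continuous_centre hST)).measurable
  have hβm : ∀ t, Measurable fun x : PathSpace S T d =>
      bridge hST hΓ.regression (centre hST x) t := fun t => (measurable_eval t).comp hβ
  have hmem : ∀ (s : Set.Icc S T) (w : EuclideanSpace ℝ (Fin d)),
      MemLp (fun x : PathSpace S T d => ⟪w, centre hST x s⟫) 2 R := fun s w =>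
    ((hG.hasGaussianLaw_eval s).map (innerSL ℝ w)).memLp_two
  have hjoint : IsGaussianProcess (Sum.elim
      (fun (_ : Unit) (x : PathSpace S T d) => centre hST x (endTime hST))
      (fun t x => bridge hST hΓ.regression (centre hST x) t)) R := by
    classical
    refine hG.of_isGaussianProcess fun s => ?_
    cases s with
    | inl u =>
      let a : ({endTime hST} : Finset (Set.Icc S T)) := ⟨endTime hST, by simp⟩
      exact ⟨{endTime hST}, ContinuousLinearMap.proj a, fun x => rfl⟩
    | inr t =>
      let a : ({t, endTime hST} : Finset (Set.Icc S T)) := ⟨t, by simp⟩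
      let b : ({t, endTime hST} : Finset (Set.Icc S T)) := ⟨endTime hST, by simp⟩
      let L : (({t, endTime hST} : Finset (Set.Icc S T)) → EuclideanSpace ℝ (Fin d)) →L[ℝ]
          EuclideanSpace ℝ (Fin d) := ContinuousLinearMap.proj a - (hΓ.regression t).comp
        (ContinuousLinearMap.proj (R := ℝ) (φ := fun _ => EuclideanSpace ℝ (Fin d)) b)
      exact ⟨{t, endTime hST}, L, fun x => rfl⟩
  have hproc := hjoint.indepFun_of_covariance_inner (fun _ => (hmeas _).aemeasurable)
    (fun t => (hβm t).aemeasurable) (fun _ t u v => by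
      have hsplit : (fun x : PathSpace S T d =>
          ⟪v, bridge hST hΓ.regression (centre hST x) t⟫) =
          (fun x => ⟪v, centre hST x t⟫) -
            fun x => ⟪ContinuousLinearMap.adjoint (hΓ.regression t) v,
              centre hST x (endTime hST)⟫ := by
        ext x
        simp only [bridge, ContinuousMap.sub_apply, drift_apply, inner_sub_right, Pi.sub_apply,
          ContinuousLinearMap.adjoint_inner_left]
      rw [hsplit, covariance_sub_right (hmem _ _) (hmem _ _) (hmem _ _),
        hR.covariance_centre hΓ, hR.covariance_centre hΓ, sub_eq_zero]
      have hadj : ContinuousLinearMap.adjoint (hΓ.regression t) =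
          Matrix.toEuclideanCLM (𝕜 := ℝ) (Γ t * pinv (Γ T)).transpose := by
        rw [← ContinuousLinearMap.star_eq_adjoint, hΓ.regression_apply, ← map_star,
          Matrix.star_eq_conjTranspose, Matrix.conjTranspose_eq_transpose_of_trivial]
      have hT : Γ (endTime hST) = Γ T := rfl
      rw [hadj, hT, ← mul_apply_eq_comp, ← map_mul, hΓ.mul_transpose_regression])
  have h₁ : IndepFun (fun x => bridge hST hΓ.regression (centre hST x))
      (fun x : PathSpace S T d => centre hST x (endTime hST)) R := by
    refine (indepFun_continuousMap ?_).symm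
    exact hproc.comp (measurable_pi_apply ()) measurable_id
  have h₂ : IndepFun (fun x : PathSpace S T d =>
      (bridge hST hΓ.regression (centre hST x), centre hST x (endTime hST)))
      (fun x => x (startTime hST)) R :=
    hR.indepFun_start_centre.symm.comp
      (φ := fun g => (bridge hST hΓ.regression g, g (endTime hST)))
      ((continuous_bridge _ hST).measurable.prodMk (measurable_eval _)) measurable_id
  have h₃ := h₁.prodMk_of_indepFun_prodMk hβ (hmeas _) (measurable_eval _) h₂
  have h₄ := h₃.symm.comp (φ := fun p : EuclideanSpace ℝ (Fin d) × EuclideanSpace ℝ (Fin d) =>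
    (p.2, p.2 + p.1)) (by fun_prop) measurable_id
  convert h₄ using 1
  · ext1 x
    simp [endpoints, startTime, endTime]
  · rfl

end Reference

/-! ### A maximal inequality for the Gaussian reference -/

lemma one_le_two_mul_gaussianReal_nonneg (v : ℝ≥0) :
    1 ≤ 2 * gaussianReal 0 v {y | 0 ≤ y} := by
  have hsymm : gaussianReal 0 v {y | y ≤ 0} = gaussianReal 0 v {y | 0 ≤ y} := by
    have h := gaussianReal_map_neg (μ := 0) (v := v)
    rw [neg_zero] at h
    conv_lhs => rw [← h]
    rw [Measure.map_apply (by fun_prop : Measurable fun x : ℝ => -x)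
      (measurableSet_le measurable_id' measurable_const)]
    congr 1
    ext y
    simp
  calc (1 : ℝ≥0∞) = gaussianReal 0 v ({y | y ≤ 0} ∪ {y | 0 ≤ y}) := by
        rw [← measure_univ (μ := gaussianReal 0 v)]
        congr 1
        ext y
        simpa using le_total y 0
    _ ≤ _ := measure_union_le _ _
    _ = 2 * gaussianReal 0 v {y | 0 ≤ y} := by rw [hsymm, two_mul]

/-- Chernoff's bound `exp (-u)`, `u = ε² / 2v`, for the Gaussian tail, weakened to `2 / u²`. The
second power of `v` is what makes the sum over the cells of a fine grid small. -/
lemma gaussianReal_tail_le (v : ℝ≥0) {ε : ℝ} (hε : 0 < ε) :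
    gaussianReal 0 v {y | ε ≤ y} ≤ ENNReal.ofReal (8 * (v : ℝ) ^ 2 / ε ^ 4) := by
  rcases eq_or_ne v 0 with rfl | hv
  · rw [gaussianReal_zero_var,
      Measure.dirac_apply' _ (measurableSet_le measurable_const measurable_id')]
    simp [hε.not_ge]
  have hv0 : (0 : ℝ) < v := NNReal.coe_pos.2 (pos_iff_ne_zero.2 hv)
  rw [← ofReal_measureReal]
  refine ENNReal.ofReal_le_ofReal ?_
  have h := measure_ge_le_exp_mul_mgf (μ := gaussianReal 0 v) (X := id) (t := ε / v) ε
    (by positivity) (integrable_exp_mul_gaussianReal _)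
  refine h.trans ?_
  rw [mgf_id_gaussianReal, ← Real.exp_add]
  set u : ℝ := ε ^ 2 / (2 * v) with hu
  have hu0 : 0 < u := by positivity
  have e₁ : -(ε / v) * ε + (0 * (ε / v) + v * (ε / v) ^ 2 / 2) = -u := by
    rw [hu]; field_simp; ring
  have e₂ : 8 * (v : ℝ) ^ 2 / ε ^ 4 = 2 / u ^ 2 := by
    rw [hu]; field_simp; ring
  rw [e₁, e₂, Real.exp_neg, inv_eq_one_div, div_le_div_iff₀ (Real.exp_pos _) (by positivity)]
  have := Real.quadratic_le_exp_of_nonneg hu0.le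
  nlinarith

section Maximal

variable {d : ℕ} {S T : ℝ} {hST : S < T} {m : Measure (EuclideanSpace ℝ (Fin d))}
  {Γ : ℝ → Matrix (Fin d) (Fin d) ℝ} {R : Measure (PathSpace S T d)}

/-- A coordinate of an increment, up to sign, is a centred Gaussian variable. -/
lemma IsGaussianReference.map_coord (hR : IsGaussianReference hST m Γ R)
    (hΓ : IsCumulant S T Γ) {s t : Set.Icc S T} (hst : s ≤ t) (i : Fin d) {c : ℝ}
    (hc : c ^ 2 = 1) :
    R.map (fun x => c * (x t - x s) i) = gaussianReal 0 ((Γ t - Γ s) i i).toNNReal := by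
  have h₁ := (measurePreserving_eval_multivariateGaussian (μ := 0)
    (hΓ.posSemidef s.2 t.2 hst) (i := i)).map_eq
  have hm : Measurable fun x : PathSpace S T d => x t - x s :=
    (measurable_eval t).sub (measurable_eval s)
  rw [← hR.increment s t hst, Measure.map_map (by fun_prop) hm] at h₁
  have h₂ := gaussianReal_map_const_mul (μ := 0) (v := ((Γ t - Γ s) i i).toNNReal) c
  have h₃ : NNReal.mk (c ^ 2) (sq_nonneg c) = 1 := by ext; simpa using hc
  rw [h₃, mul_zero, one_mul] at h₂
  rw [← h₂, ← show (0 : EuclideanSpace ℝ (Fin d)) i = 0 from rfl, ← h₁,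
    Measure.map_map (by fun_prop) (by fun_prop)]
  rfl

/-- **Lévy's maximal inequality** along finitely many times: once the increment has exceeded the
level, the remaining increment is nonnegative with conditional probability at least one half. -/
lemma IsGaussianReference.levy_maximal_finset (hR : IsGaussianReference hST m Γ R)
    (hΓ : IsCumulant S T Γ) {a b : Set.Icc S T} (F : Finset (Set.Icc S T))
    (hF : ∀ t ∈ F, a ≤ t ∧ t ≤ b) (i : Fin d) {c : ℝ} (hc : c ^ 2 = 1) (ε : ℝ) :
    R {x | ∃ t ∈ F, ε ≤ c * (x t - x a) i} ≤ 2 * R {x | ε ≤ c * (x b - x a) i} := by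
  have hcm : ∀ s t : Set.Icc S T, Measurable fun x : PathSpace S T d => c * (x t - x s) i :=
    fun s t => by
      have : Measurable fun x : PathSpace S T d => x t - x s :=
        (measurable_eval t).sub (measurable_eval s)
      fun_prop
  -- `A t` is the event that the level is first reached at time `t`.
  let A : Set.Icc S T → Set (PathSpace S T d) := fun t =>
    {x | ε ≤ c * (x t - x a) i ∧ ∀ s ∈ F, s < t → c * (x s - x a) i < ε}
  let B : Set.Icc S T → Set (PathSpace S T d) := fun t => {x | 0 ≤ c * (x b - x t) i}
  have hAm : ∀ t, MeasurableSet (A t) := fun t => by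
    have : A t = {x | ε ≤ c * (x t - x a) i} ∩
        ⋂ s ∈ F.filter (· < t), {x | c * (x s - x a) i < ε} := by
      ext x; simp [A, Finset.mem_filter]
    rw [this]
    exact (measurableSet_le measurable_const (hcm a t)).inter
      (Finset.measurableSet_biInter _ fun s _ => measurableSet_lt (hcm a s) measurable_const)
  have hBm : ∀ t, MeasurableSet (B t) := fun t => measurableSet_le measurable_const (hcm t b)
  have hAB : ∀ t ∈ F, R (A t) ≤ 2 * R (A t ∩ B t) := by
    intro t ht
    have hat := (hF t ht).1
    have htb := (hF t ht).2
    have hind := hR.indep t b htb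
    have hApre : A t = (fun (x : PathSpace S T d) (u : Set.Iic t) => x u) ⁻¹'
        ({f | ε ≤ c * (f ⟨t, Set.self_mem_Iic⟩ - f ⟨a, hat⟩) i} ∩
          ⋂ s : {s // s ∈ F ∧ s < t}, {f | c * (f ⟨s, s.2.2.le⟩ - f ⟨a, hat⟩) i < ε}) := by
      ext x
      simp only [A, Set.mem_ofPred_eq, Set.mem_preimage, Set.mem_inter_iff, Set.mem_iInter,
        Subtype.forall, and_imp]
    have hBpre : B t = (fun x : PathSpace S T d => x b - x t) ⁻¹' {w | 0 ≤ c * w i} := rfl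
    have hcoord : ∀ u v : Set.Iic t, Measurable fun f : Set.Iic t → EuclideanSpace ℝ (Fin d) =>
        c * (f u - f v) i := fun u v => by
      have : Measurable fun f : Set.Iic t → EuclideanSpace ℝ (Fin d) => f u - f v :=
        (measurable_pi_apply u).sub (measurable_pi_apply v)
      fun_prop
    have hmul : R (A t ∩ B t) = R (A t) * R (B t) := by
      rw [hApre, hBpre]
      refine hind.measure_inter_preimage_eq_mul _ _ ?_ ?_
      · have : Countable {s // s ∈ F ∧ s < t} :=
          (F.finite_toSet.subset fun s hs => hs.1 : {s | s ∈ F ∧ s < t}.Finite).countable.to_subtype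
        exact (measurableSet_le measurable_const (hcoord _ _)).inter
          (MeasurableSet.iInter fun s => measurableSet_lt (hcoord _ _) measurable_const)
      · exact measurableSet_le measurable_const (by fun_prop)
    have hhalf : 1 ≤ 2 * R (B t) := by
      have h := one_le_two_mul_gaussianReal_nonneg ((Γ b - Γ t) i i).toNNReal
      rw [← hR.map_coord hΓ htb i hc,
        Measure.map_apply (hcm t b) (measurableSet_le measurable_const measurable_id')] at h
      exact h
    calc R (A t) = R (A t) * 1 := (mul_one _).symm
      _ ≤ R (A t) * (2 * R (B t)) := by gcongr
      _ = 2 * R (A t ∩ B t) := by rw [hmul]; ring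
  have hdisj : Set.PairwiseDisjoint (F : Set (Set.Icc S T)) fun t => A t ∩ B t := by
    intro s hs t ht hst
    refine Set.disjoint_left.2 fun x hx hy => ?_
    rcases lt_or_gt_of_ne hst with h | h
    · exact absurd hx.1.1 (not_le.2 (hy.1.2 s hs h))
    · exact absurd hy.1.1 (not_le.2 (hx.1.2 t ht h))
  have hcover : {x : PathSpace S T d | ∃ t ∈ F, ε ≤ c * (x t - x a) i} ⊆ ⋃ t ∈ F, A t := by
    intro x hx
    have hfin : {t | t ∈ F ∧ ε ≤ c * (x t - x a) i}.Finite :=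
      F.finite_toSet.subset fun t ht => ht.1
    obtain ⟨t, ht, hmin⟩ := Set.exists_min_image _ id hfin hx
    refine Set.mem_iUnion₂.2 ⟨t, ht.1, ht.2, fun s hs hlt => ?_⟩
    by_contra hge
    exact absurd (hmin s ⟨hs, not_lt.1 hge⟩) (not_le.2 hlt)
  calc R {x | ∃ t ∈ F, ε ≤ c * (x t - x a) i}
      ≤ R (⋃ t ∈ F, A t) := measure_mono hcover
    _ ≤ ∑ t ∈ F, R (A t) := measure_biUnion_finset_le _ _
    _ ≤ ∑ t ∈ F, 2 * R (A t ∩ B t) := Finset.sum_le_sum hAB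
    _ = 2 * R (⋃ t ∈ F, A t ∩ B t) := by
        rw [← Finset.mul_sum, measure_biUnion_finset hdisj fun t _ => (hAm t).inter (hBm t)]
    _ ≤ 2 * R {x | ε ≤ c * (x b - x a) i} := by
        gcongr
        refine Set.iUnion₂_subset fun t _ x hx => ?_
        have h₁ : ε ≤ c * (x t - x a) i := hx.1.1
        have h₂ : 0 ≤ c * (x b - x t) i := hx.2
        have h₃ : c * (x b - x a) i = c * (x b - x t) i + c * (x t - x a) i := by
          simp only [PiLp.sub_apply]; ring
        change ε ≤ c * (x b - x a) i
        linarith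

/-- The maximal inequality for one coordinate of the path over a time interval. -/
lemma IsGaussianReference.maximal (hR : IsGaussianReference hST m Γ R)
    (hΓ : IsCumulant S T Γ) {a b : Set.Icc S T} (hab : a ≤ b) (i : Fin d) {ε : ℝ} (hε : 0 < ε) :
    R {x | ∃ t, a ≤ t ∧ t ≤ b ∧ ε < |(x t - x a) i|} ≤
      ENNReal.ofReal (32 * ((Γ b - Γ a) i i) ^ 2 / ε ^ 4) := by
  have hv : 0 ≤ (Γ b - Γ a) i i := (hΓ.posSemidef a.2 b.2 hab).diag_nonneg
  have : Nonempty (Set.Icc a b) := ⟨⟨a, Set.left_mem_Icc.2 hab⟩⟩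
  obtain ⟨u, hu⟩ := TopologicalSpace.exists_dense_seq (Set.Icc a b)
  have hone : ∀ c : ℝ, c ^ 2 = 1 →
      R {x | ∃ t, a ≤ t ∧ t ≤ b ∧ ε < c * (x t - x a) i} ≤
        ENNReal.ofReal (16 * ((Γ b - Γ a) i i) ^ 2 / ε ^ 4) := by
    intro c hc
    classical
    let F : ℕ → Finset (Set.Icc S T) := fun n => (Finset.range n).image fun k => (u k : Set.Icc S T)
    have hsub : {x : PathSpace S T d | ∃ t, a ≤ t ∧ t ≤ b ∧ ε < c * (x t - x a) i} ⊆
        ⋃ n, {x | ∃ t ∈ F n, ε ≤ c * (x t - x a) i} := by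
      rintro x ⟨t, hat, htb, ht⟩
      have hopen : IsOpen {s : Set.Icc a b | ε < c * (x s - x a) i} :=
        isOpen_lt continuous_const (by fun_prop)
      obtain ⟨_, hs, ⟨k, rfl⟩⟩ := hu.inter_open_nonempty _ hopen ⟨⟨t, hat, htb⟩, ht⟩
      refine Set.mem_iUnion.2 ⟨k + 1, u k, ?_, le_of_lt hs⟩
      exact Finset.mem_image_of_mem _ (Finset.self_mem_range_succ k)
    have hmono : Monotone fun n => {x : PathSpace S T d | ∃ t ∈ F n, ε ≤ c * (x t - x a) i} := by
      rintro k n hkn x ⟨t, ht, h⟩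
      exact ⟨t, Finset.image_subset_image (Finset.range_mono hkn) ht, h⟩
    refine (measure_mono hsub).trans ?_
    rw [hmono.measure_iUnion]
    refine iSup_le fun n => (hR.levy_maximal_finset hΓ (b := b) (F n) ?_ i hc ε).trans ?_
    · intro t ht
      obtain ⟨k, -, rfl⟩ := Finset.mem_image.1 ht
      exact (u k).2
    · have hm : Measurable fun x : PathSpace S T d => c * (x b - x a) i := by
        have : Measurable fun x : PathSpace S T d => x b - x a :=
          (measurable_eval b).sub (measurable_eval a)
        fun_prop
      have h := gaussianReal_tail_le ((Γ b - Γ a) i i).toNNReal hε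
      rw [← hR.map_coord hΓ hab i hc, Measure.map_apply hm
        (measurableSet_le measurable_const measurable_id'),
        Real.coe_toNNReal _ hv] at h
      calc 2 * R {x | ε ≤ c * (x b - x a) i}
          ≤ 2 * ENNReal.ofReal (8 * ((Γ b - Γ a) i i) ^ 2 / ε ^ 4) := by gcongr; exact h
        _ = ENNReal.ofReal (16 * ((Γ b - Γ a) i i) ^ 2 / ε ^ 4) := by
          rw [← ENNReal.ofReal_ofNat 2, ← ENNReal.ofReal_mul (by norm_num)]
          congr 1
          ring
  calc R {x | ∃ t, a ≤ t ∧ t ≤ b ∧ ε < |(x t - x a) i|}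
      ≤ R ({x | ∃ t, a ≤ t ∧ t ≤ b ∧ ε < 1 * (x t - x a) i} ∪
          {x | ∃ t, a ≤ t ∧ t ≤ b ∧ ε < -1 * (x t - x a) i}) := by
        refine measure_mono ?_
        rintro x ⟨t, hat, htb, h⟩
        rcases lt_abs.1 h with h | h
        · exact Or.inl ⟨t, hat, htb, by rwa [one_mul]⟩
        · exact Or.inr ⟨t, hat, htb, by rwa [neg_one_mul]⟩
    _ ≤ _ := measure_union_le _ _
    _ ≤ ENNReal.ofReal (16 * ((Γ b - Γ a) i i) ^ 2 / ε ^ 4) +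
        ENNReal.ofReal (16 * ((Γ b - Γ a) i i) ^ 2 / ε ^ 4) :=
        add_le_add (hone 1 (by norm_num)) (hone (-1) (by norm_num))
    _ = ENNReal.ofReal (32 * ((Γ b - Γ a) i i) ^ 2 / ε ^ 4) := by
        rw [← ENNReal.ofReal_add (by positivity) (by positivity)]
        congr 1
        ring

end Maximal

/-! ### Finite-dimensional approximation of the centred reference -/

/-- The centred Gaussian law on `ℝ^d` with covariance `C`, as a bundled probability measure. -/
noncomputable def centredGaussian {d : ℕ} (C : Matrix (Fin d) (Fin d) ℝ) :
    ProbabilityMeasure (EuclideanSpace ℝ (Fin d)) :=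
  ⟨multivariateGaussian 0 C, inferInstance⟩

/-- Centred Gaussian laws on `ℝ^d` depend weakly continuously on the covariance. -/
lemma tendsto_centredGaussian {d : ℕ} {C : ℕ → Matrix (Fin d) (Fin d) ℝ}
    {C₀ : Matrix (Fin d) (Fin d) ℝ} (hC : ∀ n, (C n).PosSemidef) (hC₀ : C₀.PosSemidef)
    (h : Tendsto C atTop (𝓝 C₀)) :
    Tendsto (fun n => centredGaussian (C n)) atTop (𝓝 (centredGaussian C₀)) := by
  refine ProbabilityMeasure.tendsto_of_tendsto_charFun fun t => ?_
  have hcont : Continuous fun M : Matrix (Fin d) (Fin d) ℝ =>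
      Complex.exp (inner ℝ t (0 : EuclideanSpace ℝ (Fin d)) * Complex.I -
        (t.ofLp ⬝ᵥ M.mulVec t.ofLp : ℝ) / 2) := by
    fun_prop
  have := (hcont.tendsto C₀).comp h
  simp only [Function.comp_def] at this
  simp only [centredGaussian, ProbabilityMeasure.coe_mk]
  rw [charFun_multivariateGaussian hC₀]
  simp_rw [charFun_multivariateGaussian (hC _)]
  exact this

lemma norm_le_card_mul_of_forall_abs_le {d : ℕ} (w : EuclideanSpace ℝ (Fin d)) {c : ℝ}
    (h : ∀ i, |w i| ≤ c) : ‖w‖ ≤ d * c := by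
  have hw := (EuclideanSpace.basisFun (Fin d) ℝ).sum_repr w
  rw [← hw]
  refine (norm_sum_le _ _).trans ?_
  calc ∑ i, ‖(EuclideanSpace.basisFun (Fin d) ℝ).repr w i • EuclideanSpace.basisFun (Fin d) ℝ i‖
      ≤ ∑ _i : Fin d, c := Finset.sum_le_sum fun i _ => by
        rw [norm_smul, OrthonormalBasis.norm_eq_one, mul_one]
        simpa using h i
    _ = d * c := by simp

namespace SubGrid

variable {S T : ℝ}

lemma fraction_eq_one (P : SubGrid S T) {k : ℕ} (hk : k < P.M) {t : ℝ}
    (ht : P.point (k + 1) ≤ t) : P.fraction k t = 1 := by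
  have hpos := sub_pos.2 (P.lt_succ k hk)
  have : 1 ≤ (t - P.point k) / (P.point (k + 1) - P.point k) := by
    rw [le_div_iff₀ hpos]; linarith
  simp [fraction, min_eq_left this]

lemma fraction_eq_zero (P : SubGrid S T) {k : ℕ} (hk : k < P.M) {t : ℝ}
    (ht : t ≤ P.point k) : P.fraction k t = 0 := by
  have hpos := sub_pos.2 (P.lt_succ k hk)
  have : (t - P.point k) / (P.point (k + 1) - P.point k) ≤ 0 :=
    div_nonpos_of_nonpos_of_nonneg (by linarith) hpos.le
  rw [fraction, max_eq_left ((min_le_right _ _).trans this)]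

lemma fraction_nonneg (P : SubGrid S T) (k : ℕ) (t : ℝ) : 0 ≤ P.fraction k t := le_max_left _ _

lemma fraction_le_one (P : SubGrid S T) (k : ℕ) (t : ℝ) : P.fraction k t ≤ 1 :=
  max_le zero_le_one (min_le_left _ _)

/-- On a cell of the grid a piecewise affine function is affine. -/
lemma sum_fraction_smul {E : Type*} [AddCommGroup E] [Module ℝ E] (P : SubGrid S T) (f : ℕ → E)
    {k : ℕ} (hk : k < P.M) {t : ℝ} (h₁ : P.point k ≤ t) (h₂ : t ≤ P.point (k + 1)) :
    ∑ j ∈ Finset.range P.M, P.fraction j t • (f (j + 1) - f j) =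
      f k - f 0 + P.fraction k t • (f (k + 1) - f k) := by
  rw [← Finset.sum_range_add_sum_Ico _ (show k + 1 ≤ P.M from hk), Finset.sum_range_succ,
    ← Finset.sum_range_sub f k]
  have e₂ : ∑ j ∈ Finset.Ico (k + 1) P.M, P.fraction j t • (f (j + 1) - f j) = 0 := by
    refine Finset.sum_eq_zero fun j hj => ?_
    rw [Finset.mem_Ico] at hj
    rw [P.fraction_eq_zero hj.2 (h₂.trans (P.point_mono hj.1 hj.2.le)), zero_smul]
  rw [e₂, add_zero]
  congr 1
  refine Finset.sum_congr rfl fun j hj => ?_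
  have hj' := Finset.mem_range.1 hj
  rw [P.fraction_eq_one (by omega) ((P.point_mono (by omega) hk.le).trans h₁), one_smul]

lemma exists_cell (P : SubGrid S T) (hST : S < T) {t : ℝ} (ht : t ∈ Set.Icc S T) :
    ∃ k < P.M, P.point k ≤ t ∧ t ≤ P.point (k + 1) := by
  classical
  have hex : ∃ k, k < P.M ∧ t ≤ P.point (k + 1) :=
    ⟨P.M - 1, by have := P.M_pos hST; omega, by
      have : P.M - 1 + 1 = P.M := by have := P.M_pos hST; omega
      rw [this, P.last]; exact ht.2⟩
  obtain ⟨hk, hle⟩ := Nat.find_spec hex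
  refine ⟨Nat.find hex, hk, ?_, hle⟩
  rcases Nat.eq_zero_or_pos (Nat.find hex) with h | h
  · rw [h, P.first]; exact ht.1
  · have hmin := Nat.find_min hex (m := Nat.find hex - 1) (by omega)
    rw [not_and, not_le] at hmin
    have := hmin (by omega)
    rw [Nat.sub_add_cancel h] at this
    exact this.le

/-- The grid points as elements of `[S,T]`, continued by the last one. -/
def time (P : SubGrid S T) (k : ℕ) : Set.Icc S T :=
  ⟨P.point (min k P.M), P.point_mem (min_le_right _ _)⟩

lemma time_mono (P : SubGrid S T) : Monotone P.time := fun a b hab =>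
  Subtype.mk_le_mk.2 (P.point_mono (by omega) (by omega))

lemma coe_time (P : SubGrid S T) {k : ℕ} (hk : k ≤ P.M) : (P.time k : ℝ) = P.point k := by
  simp [time, min_eq_left hk]

/-- The equidistant grid with `M + 1` cells. -/
noncomputable def uniform (hST : S < T) (M : ℕ) : SubGrid S T where
  M := M + 1
  point k := S + (T - S) * (k / (M + 1))
  lt_succ k _ := by
    have := sub_pos.2 hST
    gcongr
    simp
  first := by simp
  last := by
    have : (M : ℝ) + 1 ≠ 0 := by positivity
    push_cast
    rw [div_self this]
    ring

variable {d : ℕ}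

/-- The piecewise affine path starting at the origin with given increments over the cells. -/
noncomputable def polygon (P : SubGrid S T) (v : Fin P.M → EuclideanSpace ℝ (Fin d)) :
    PathSpace S T d :=
  ∑ k : Fin P.M, (⟨fun t => P.fraction k t • v k, by
    have := P.continuous_fraction k
    fun_prop⟩ : PathSpace S T d)

lemma polygon_apply (P : SubGrid S T) (v : Fin P.M → EuclideanSpace ℝ (Fin d)) (t : Set.Icc S T) :
    P.polygon v t = ∑ k : Fin P.M, P.fraction k t • v k := by
  simp [polygon, ContinuousMap.sum_apply]

lemma continuous_polygon (P : SubGrid S T) : Continuous (P.polygon (d := d)) := by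
  refine ContinuousMap.continuous_of_continuous_uncurry _ ?_
  change Continuous fun p : (Fin P.M → EuclideanSpace ℝ (Fin d)) × Set.Icc S T => P.polygon p.1 p.2
  simp only [polygon_apply]
  have := fun k => P.continuous_fraction k
  fun_prop

/-- The increments of a path over the cells of a grid. -/
def increments (P : SubGrid S T) (x : PathSpace S T d) (k : Fin P.M) : EuclideanSpace ℝ (Fin d) :=
  x (P.time (k + 1)) - x (P.time k)

lemma measurable_increments (P : SubGrid S T) : Measurable (P.increments (d := d)) :=
  measurable_pi_lambda _ fun _ => (measurable_eval _).sub (measurable_eval _)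

lemma polygon_increments_apply (P : SubGrid S T) (x : PathSpace S T d) {k : ℕ} (hk : k < P.M)
    {t : Set.Icc S T} (h₁ : P.point k ≤ t) (h₂ : t ≤ P.point (k + 1)) :
    P.polygon (P.increments x) t = x (P.time k) - x (P.time 0) +
      P.fraction k t • (x (P.time (k + 1)) - x (P.time k)) := by
  rw [← P.sum_fraction_smul (fun j => x (P.time j)) hk h₁ h₂, polygon_apply,
    ← Fin.sum_univ_eq_sum_range
      (fun j => P.fraction j t • (x (P.time (j + 1)) - x (P.time j))) P.M]
  rfl

/-- A path is close to its interpolation along a grid if it oscillates little in the cells. -/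
lemma dist_centre_polygon_le (P : SubGrid S T) (hST : S < T) (x : PathSpace S T d) {ε : ℝ}
    (hε : 0 ≤ ε)
    (h : ∀ k < P.M, ∀ i, ∀ t, P.time k ≤ t → t ≤ P.time (k + 1) → |(x t - x (P.time k)) i| ≤ ε) :
    dist (centre hST x) (P.polygon (P.increments x)) ≤ 2 * (d * ε) := by
  rw [ContinuousMap.dist_le (by positivity)]
  intro t
  obtain ⟨k, hk, h₁, h₂⟩ := P.exists_cell hST t.2
  have h₁' : P.time k ≤ t := by rw [← Subtype.coe_le_coe, P.coe_time hk.le]; exact h₁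
  have h₂' : t ≤ P.time (k + 1) := by rw [← Subtype.coe_le_coe, P.coe_time hk]; exact h₂
  have h0 : P.time 0 = startTime hST :=
    Subtype.ext (by rw [P.coe_time (Nat.zero_le _), P.first]; rfl)
  rw [P.polygon_increments_apply x hk h₁ h₂, centre_apply, h0, dist_eq_norm]
  have e : x t - x (startTime hST) - (x (P.time k) - x (startTime hST) +
      P.fraction k t • (x (P.time (k + 1)) - x (P.time k))) =
      (x t - x (P.time k)) - P.fraction k t • (x (P.time (k + 1)) - x (P.time k)) := by abel
  rw [e]
  have b₁ : ‖x t - x (P.time k)‖ ≤ d * ε :=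
    norm_le_card_mul_of_forall_abs_le _ fun i => h k hk i t h₁' h₂'
  have b₂ : ‖x (P.time (k + 1)) - x (P.time k)‖ ≤ d * ε :=
    norm_le_card_mul_of_forall_abs_le _ fun i => h k hk i _ (P.time_mono k.le_succ) le_rfl
  calc _ ≤ ‖x t - x (P.time k)‖ + ‖P.fraction k t • (x (P.time (k + 1)) - x (P.time k))‖ :=
        norm_sub_le _ _
    _ ≤ d * ε + 1 * (d * ε) := by
        rw [norm_smul, Real.norm_of_nonneg (P.fraction_nonneg _ _)]
        exact add_le_add b₁ (mul_le_mul (P.fraction_le_one _ _) b₂ (norm_nonneg _) zero_le_one)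
    _ = 2 * (d * ε) := by ring

/-- The sum of the squared variances of the coordinates of the increments over the cells. -/
noncomputable def sumSqVar (P : SubGrid S T) (Γ : ℝ → Matrix (Fin d) (Fin d) ℝ) : ℝ :=
  ∑ k ∈ Finset.range P.M, ∑ i, ((Γ (P.time (k + 1)) - Γ (P.time k)) i i) ^ 2

end SubGrid

section Approximation

variable {d : ℕ} {S T : ℝ} {hST : S < T} {m : Measure (EuclideanSpace ℝ (Fin d))}
  {Γ : ℝ → Matrix (Fin d) (Fin d) ℝ} {R : Measure (PathSpace S T d)}

/-- Continuity of the cumulant makes the sum of squared variances small along a fine grid. -/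
lemma IsCumulant.exists_sumSqVar_le (hΓ : IsCumulant S T Γ) (hST : S < T) {κ : ℝ} (hκ : 0 < κ) :
    ∃ P : SubGrid S T, P.sumSqVar Γ ≤ κ := by
  have hTnn : ∀ i, 0 ≤ Γ T i i := fun i =>
    (hΓ.posSemidef_apply ⟨T, Set.right_mem_Icc.2 hST.le⟩).diag_nonneg
  set c : ℝ := κ / (1 + ∑ i, Γ T i i) with hc
  have hsum : 0 ≤ ∑ i, Γ T i i := Finset.sum_nonneg fun i _ => hTnn i
  have hc0 : 0 < c := by positivity
  have huc : UniformContinuous fun t : Set.Icc S T => fun i => Γ t i i := by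
    refine CompactSpace.uniformContinuous_of_continuous (continuous_pi fun i => ?_)
    exact (continuousOn_iff_continuous_domRestrict.1 hΓ.continuousOn).matrix_elem i i
  obtain ⟨δ, hδ, h⟩ := Metric.uniformContinuous_iff.1 huc c hc0
  obtain ⟨M, hM⟩ := exists_nat_gt ((T - S) / δ)
  refine ⟨SubGrid.uniform hST M, ?_⟩
  set P := SubGrid.uniform hST M with hP
  have hstep : ∀ k < P.M, ∀ i, (Γ (P.time (k + 1)) - Γ (P.time k)) i i ≤ c := by
    intro k hk i
    have hd : dist (P.time (k + 1)) (P.time k) < δ := by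
      rw [Subtype.dist_eq, P.coe_time hk, P.coe_time hk.le, Real.dist_eq]
      have hM0 : (0 : ℝ) < M + 1 := by positivity
      have e : P.point (k + 1) - P.point k = (T - S) / (M + 1) := by
        simp only [hP, SubGrid.uniform]
        push_cast
        ring
      rw [e, abs_of_pos (by have := sub_pos.2 hST; positivity), div_lt_iff₀ hM0]
      rw [div_lt_iff₀ hδ] at hM
      nlinarith
    have := (dist_pi_lt_iff hc0).1 (h hd) i
    rw [Real.dist_eq] at this
    exact (le_abs_self _).trans this.le
  have hnn : ∀ k i, 0 ≤ (Γ (P.time (k + 1)) - Γ (P.time k)) i i := fun k i =>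
    (hΓ.posSemidef (P.time k).2 (P.time (k + 1)).2 (P.time_mono k.le_succ)).diag_nonneg
  calc P.sumSqVar Γ
      ≤ ∑ k ∈ Finset.range P.M, ∑ i, c * (Γ (P.time (k + 1)) - Γ (P.time k)) i i := by
        refine Finset.sum_le_sum fun k hk => Finset.sum_le_sum fun i _ => ?_
        rw [sq]
        exact mul_le_mul_of_nonneg_right (hstep k (Finset.mem_range.1 hk) i) (hnn k i)
    _ = c * ∑ i, ∑ k ∈ Finset.range P.M, (Γ (P.time (k + 1)) i i - Γ (P.time k) i i) := by
        rw [Finset.sum_comm, Finset.mul_sum]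
        refine Finset.sum_congr rfl fun i _ => ?_
        rw [Finset.mul_sum]
        rfl
    _ = c * ∑ i, Γ T i i := by
        congr 1
        refine Finset.sum_congr rfl fun i _ => ?_
        rw [Finset.sum_range_sub (fun k => Γ (P.time k) i i), P.coe_time le_rfl,
          P.coe_time (Nat.zero_le _), P.first, P.last, hΓ.zero]
        simp
    _ ≤ κ := by
        rw [hc, div_mul_eq_mul_div, div_le_iff₀ (by positivity)]
        nlinarith

/-- The path oscillates by more than `ε` in some cell with small probability only. -/
lemma IsGaussianReference.measure_oscillation_le (hR : IsGaussianReference hST m Γ R)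
    (hΓ : IsCumulant S T Γ) (P : SubGrid S T) {ε : ℝ} (hε : 0 < ε) :
    R {x | ∃ k < P.M, ∃ i, ∃ t, P.time k ≤ t ∧ t ≤ P.time (k + 1) ∧
      ε < |(x t - x (P.time k)) i|} ≤ ENNReal.ofReal (32 * P.sumSqVar Γ / ε ^ 4) := by
  have hsub : {x : PathSpace S T d | ∃ k < P.M, ∃ i, ∃ t, P.time k ≤ t ∧ t ≤ P.time (k + 1) ∧
      ε < |(x t - x (P.time k)) i|} ⊆ ⋃ k ∈ Finset.range P.M, ⋃ i ∈ (Finset.univ : Finset (Fin d)),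
        {x | ∃ t, P.time k ≤ t ∧ t ≤ P.time (k + 1) ∧ ε < |(x t - x (P.time k)) i|} := by
    rintro x ⟨k, hk, i, h⟩
    exact Set.mem_iUnion₂.2 ⟨k, Finset.mem_range.2 hk,
      Set.mem_iUnion₂.2 ⟨i, Finset.mem_univ i, h⟩⟩
  refine (measure_mono hsub).trans ((measure_biUnion_finset_le _ _).trans ?_)
  have hnn : ∀ k, 0 ≤ ∑ i, 32 * ((Γ (P.time (k + 1)) - Γ (P.time k)) i i) ^ 2 / ε ^ 4 := fun k =>
    Finset.sum_nonneg fun i _ => by positivity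
  have e : 32 * P.sumSqVar Γ / ε ^ 4 = ∑ k ∈ Finset.range P.M,
      ∑ i, 32 * ((Γ (P.time (k + 1)) - Γ (P.time k)) i i) ^ 2 / ε ^ 4 := by
    simp only [SubGrid.sumSqVar, Finset.mul_sum, Finset.sum_div]
  rw [e, ENNReal.ofReal_sum_of_nonneg fun k _ => hnn k]
  refine Finset.sum_le_sum fun k _ => (measure_biUnion_finset_le _ _).trans ?_
  rw [ENNReal.ofReal_sum_of_nonneg fun i _ => by positivity]
  exact Finset.sum_le_sum fun i _ => hR.maximal hΓ (P.time_mono k.le_succ) i hε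

variable [IsProbabilityMeasure R]

/-- Replacing the path by its interpolation along a grid changes expectations by little, uniformly
over all references with a small sum of squared variances. -/
lemma IsGaussianReference.abs_integral_centre_sub_le (hR : IsGaussianReference hST m Γ R)
    (hΓ : IsCumulant S T Γ) (P : SubGrid S T) {ε : ℝ} (hε : 0 < ε) {F : PathSpace S T d → ℝ}
    {B : ℝ} {K : ℝ≥0} (hB : ∀ x y, dist (F x) (F y) ≤ B) (hK : LipschitzWith K F) :
    |∫ x, F (centre hST x) ∂(R) - ∫ x, F (P.polygon (P.increments x)) ∂(R)| ≤
      K * (2 * (d * ε)) + B * (32 * P.sumSqVar Γ / ε ^ 4) := by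
  have hB0 : 0 ≤ B := dist_nonneg.trans (hB 0 0)
  set bad : Set (PathSpace S T d) := {x | ∃ k < P.M, ∃ i, ∃ t, P.time k ≤ t ∧
    t ≤ P.time (k + 1) ∧ ε < |(x t - x (P.time k)) i|} with hbad
  have hint : ∀ φ : PathSpace S T d → PathSpace S T d, Measurable φ →
      Integrable (fun x => F (φ x)) R := fun φ hφ => by
    refine Integrable.of_bound (hK.continuous.measurable.comp hφ).aestronglyMeasurable
      (‖F 0‖ + B) (ae_of_all _ fun x => ?_)
    calc ‖F (φ x)‖ = ‖F 0 + (F (φ x) - F 0)‖ := by congr 1; ring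
      _ ≤ ‖F 0‖ + ‖F (φ x) - F 0‖ := norm_add_le _ _
      _ ≤ ‖F 0‖ + B := by gcongr; exact hB _ _
  have hpoint : ∀ x, |F (centre hST x) - F (P.polygon (P.increments x))| ≤
      K * (2 * (d * ε)) + (toMeasurable R bad).indicator (fun _ => B) x := by
    intro x
    by_cases hx : x ∈ toMeasurable R bad
    · rw [Set.indicator_of_mem hx]
      have h0 : 0 ≤ K * (2 * (d * ε)) := by positivity
      exact (hB _ _).trans (by linarith)
    · rw [Set.indicator_of_notMem hx, add_zero]
      have hx' : x ∉ bad := fun h => hx (subset_toMeasurable _ _ h)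
      refine (hK.dist_le_mul _ _).trans (mul_le_mul_of_nonneg_left ?_ K.2)
      refine P.dist_centre_polygon_le hST x hε.le fun k hk i t h₁ h₂ => ?_
      by_contra hlt
      exact hx' ⟨k, hk, i, t, h₁, h₂, not_le.1 hlt⟩
  have hS0 : 0 ≤ P.sumSqVar Γ :=
    Finset.sum_nonneg fun k _ => Finset.sum_nonneg fun i _ => sq_nonneg _
  rw [← integral_sub (hint _ (continuous_centre hST).measurable)
    (hint (fun x => P.polygon (P.increments x))
      (P.continuous_polygon.measurable.comp P.measurable_increments))]
  refine (abs_integral_le_integral_abs).trans ?_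
  refine (integral_mono_of_nonneg (ae_of_all _ fun _ => abs_nonneg _)
    ((integrable_const _).add ((integrable_const B).indicator (measurableSet_toMeasurable _ _)))
    (ae_of_all _ hpoint)).trans ?_
  rw [integral_add' (integrable_const _)
    ((integrable_const B).indicator (measurableSet_toMeasurable _ _)),
    integral_indicator_const _ (measurableSet_toMeasurable _ _)]
  simp only [integral_const, probReal_univ, smul_eq_mul, one_mul]
  rw [mul_comm B]
  gcongr
  rw [measureReal_def, measure_toMeasurable]
  exact ENNReal.toReal_le_of_le_ofReal (by positivity) (hR.measure_oscillation_le hΓ P hε)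

lemma IsGaussianReference.map_increments (hR : IsGaussianReference hST m Γ R) (P : SubGrid S T) :
    R.map P.increments = Measure.pi fun k : Fin P.M =>
      multivariateGaussian 0 (Γ (P.time (k + 1)) - Γ (P.time k)) := by
  have h := (hR.iIndepFun_increments P.time_mono).precomp
    (g := fun k : Fin P.M => (k : ℕ) + 1) fun a b hab => Fin.ext (Nat.succ_injective hab)
  have h' := h.map_fun_eq_pi_map fun k => (measurable_startAndIncrements _ _).aemeasurable
  change R.map P.increments = _ at h'
  rw [h']
  congr 1
  ext1 k
  exact hR.increment _ _ (P.time_mono (Nat.le_succ _))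

/-- Pointwise convergence of the cumulants implies weak convergence of the laws of the paths
translated to start at the origin. -/
theorem tendsto_integral_centre {mn : ℕ → Measure (EuclideanSpace ℝ (Fin d))}
    {Γn : ℕ → ℝ → Matrix (Fin d) (Fin d) ℝ} {Rn : ℕ → Measure (PathSpace S T d)}
    [∀ n, IsProbabilityMeasure (Rn n)] (hR : IsGaussianReference hST m Γ R)
    (hΓ : IsCumulant S T Γ) (hRn : ∀ n, IsGaussianReference hST (mn n) (Γn n) (Rn n))
    (hΓn : ∀ n, IsCumulant S T (Γn n))
    (hconv : ∀ t ∈ Set.Icc S T, Tendsto (fun n => Γn n t) atTop (𝓝 (Γ t)))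
    {F : PathSpace S T d → ℝ} {B : ℝ} {K : ℝ≥0} (hB : ∀ x y, dist (F x) (F y) ≤ B)
    (hK : LipschitzWith K F) :
    Tendsto (fun n => ∫ x, F (centre hST x) ∂(Rn n)) atTop
      (𝓝 (∫ x, F (centre hST x) ∂(R))) := by
  have hB0 : 0 ≤ B := dist_nonneg.trans (hB 0 0)
  -- For a fixed grid the laws of the increments converge, being finite products of Gaussian laws.
  have hgrid : ∀ P : SubGrid S T,
      Tendsto (fun n => ∫ x, F (P.polygon (P.increments x)) ∂(Rn n)) atTop
        (𝓝 (∫ x, F (P.polygon (P.increments x)) ∂(R))) := by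
    intro P
    let Φ : BoundedContinuousFunction (Fin P.M → EuclideanSpace ℝ (Fin d)) ℝ :=
      ⟨⟨fun v => F (P.polygon v), hK.continuous.comp P.continuous_polygon⟩, B, fun _ _ => hB _ _⟩
    have hlaw : ∀ {m' : Measure (EuclideanSpace ℝ (Fin d))}
        {Γ' : ℝ → Matrix (Fin d) (Fin d) ℝ} {R' : Measure (PathSpace S T d)}
        [IsProbabilityMeasure R'], IsGaussianReference hST m' Γ' R' →
        ∫ x, F (P.polygon (P.increments x)) ∂(R') = ∫ v, Φ v ∂(Measure.pi fun k : Fin P.M =>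
          multivariateGaussian 0 (Γ' (P.time (k + 1)) - Γ' (P.time k))) := by
      intro m' Γ' R' _ h
      rw [← h.map_increments P, integral_map P.measurable_increments.aemeasurable
        Φ.continuous.measurable.aestronglyMeasurable]
      rfl
    rw [hlaw hR]
    simp_rw [hlaw (hRn _)]
    have hpi : Tendsto (fun n => ProbabilityMeasure.pi fun k : Fin P.M =>
        centredGaussian (Γn n (P.time (k + 1)) - Γn n (P.time k))) atTop
        (𝓝 (ProbabilityMeasure.pi fun k : Fin P.M =>
          centredGaussian (Γ (P.time (k + 1)) - Γ (P.time k)))) := by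
      refine (ProbabilityMeasure.continuous_pi.tendsto _).comp (tendsto_pi_nhds.2 fun k => ?_)
      exact tendsto_centredGaussian
        (fun n => (hΓn n).posSemidef (P.time k).2 (P.time (k + 1)).2 (P.time_mono (Nat.le_succ _)))
        (hΓ.posSemidef (P.time k).2 (P.time (k + 1)).2 (P.time_mono (Nat.le_succ _)))
        ((hconv _ (P.time _).2).sub (hconv _ (P.time _).2))
    exact ProbabilityMeasure.tendsto_iff_forall_integral_tendsto.1 hpi Φ
  have hvar : ∀ P : SubGrid S T,
      Tendsto (fun n => P.sumSqVar (Γn n)) atTop (𝓝 (P.sumSqVar Γ)) := by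
    intro P
    refine tendsto_finsetSum _ fun k _ => tendsto_finsetSum _ fun i _ => Tendsto.pow ?_ 2
    have h := (hconv _ (P.time (k + 1)).2).sub (hconv _ (P.time k).2)
    exact tendsto_pi_nhds.1 (tendsto_pi_nhds.1 h i) i
  refine Metric.tendsto_atTop'.2 fun δ hδ => ?_
  -- `ε` makes the Lipschitz part of the approximation error at most `δ / 8`, and `κ` bounds the sum
  -- of squared variances so that the contribution of large oscillations is at most `δ / 8` as well.
  set ε : ℝ := δ / (16 * (K * d + 1)) with hε
  have hε0 : 0 < ε := by positivity
  have hεle : K * (2 * (d * ε)) ≤ δ / 8 := by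
    have : (K * d + 1) * ε = δ / 16 := by rw [hε]; field_simp
    nlinarith
  set κ : ℝ := δ * ε ^ 4 / (512 * (B + 1)) with hκ
  have hκ0 : 0 < κ := by positivity
  have hκle : ∀ s : ℝ, s ≤ 2 * κ → B * (32 * s / ε ^ 4) ≤ δ / 8 := by
    intro s hs
    have h₁ : B * (32 * s / ε ^ 4) ≤ B * (32 * (2 * κ) / ε ^ 4) := by gcongr
    have h₂ : B * (32 * (2 * κ) / ε ^ 4) = δ / 8 * (B / (B + 1)) := by
      rw [hκ]; field_simp; ring
    have h₃ : B / (B + 1) ≤ 1 := (div_le_one (by positivity)).2 (by linarith)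
    rw [h₂] at h₁
    nlinarith
  obtain ⟨P, hP⟩ := hΓ.exists_sumSqVar_le hST hκ0
  have hev₁ : ∀ᶠ n in atTop, P.sumSqVar (Γn n) < 2 * κ :=
    (hvar P).eventually_lt_const (by linarith)
  have hev₂ := (Metric.tendsto_nhds.1 (hgrid P)) (δ / 4) (by positivity)
  obtain ⟨N, hN⟩ := eventually_atTop.1 (hev₁.and hev₂)
  refine ⟨N, fun n hn => ?_⟩
  obtain ⟨h₁, h₂⟩ := hN n hn.le
  have a₁ := (hRn n).abs_integral_centre_sub_le (hΓn n) P hε0 hB hK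
  have a₂ := hR.abs_integral_centre_sub_le hΓ P hε0 hB hK
  have b₁ := hκle _ h₁.le
  have b₂ := hκle (P.sumSqVar Γ) (by linarith)
  rw [Real.dist_eq] at h₂ ⊢
  rw [abs_lt] at h₂ ⊢
  rw [abs_le] at a₁ a₂
  constructor <;> linarith [h₂.1, h₂.2, a₁.1, a₁.2, a₂.1, a₂.2]

end Approximation

/-! ### Stability in a fixed environment -/

section Pinning

variable {d : ℕ} {S T : ℝ}
  (A A' : C(Set.Icc S T, EuclideanSpace ℝ (Fin d) →L[ℝ] EuclideanSpace ℝ (Fin d)))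

/-- The path `g`, started at the origin, moved to the endpoints `p` along `A`. -/
noncomputable def pin (hST : S < T) (p : EuclideanSpace ℝ (Fin d) × EuclideanSpace ℝ (Fin d))
    (g : PathSpace S T d) : PathSpace S T d :=
  assemble A (p, bridge hST A g)

lemma pin_apply (hST : S < T) (p : EuclideanSpace ℝ (Fin d) × EuclideanSpace ℝ (Fin d))
    (g : PathSpace S T d) (t : Set.Icc S T) :
    pin A hST p g t = p.1 + g t + A t (p.2 - p.1 - g (endTime hST)) := by
  simp only [pin, assemble, bridge, ContinuousMap.add_apply, ContinuousMap.const_apply,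
    drift_apply, ContinuousMap.sub_apply, map_sub]
  abel

lemma continuous_pin (hST : S < T) :
    Continuous fun q : (EuclideanSpace ℝ (Fin d) × EuclideanSpace ℝ (Fin d)) × PathSpace S T d =>
      pin A hST q.1 q.2 :=
  (continuous_assemble A).comp (continuous_fst.prodMk
    ((continuous_bridge A hST).comp continuous_snd))

lemma dist_pin_pin_le (hST : S < T) (p : EuclideanSpace ℝ (Fin d) × EuclideanSpace ℝ (Fin d))
    (g : PathSpace S T d) :
    dist (pin A hST p g) (pin A' hST p g) ≤ ‖A - A'‖ * ‖p.2 - p.1 - g (endTime hST)‖ := by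
  refine (ContinuousMap.dist_le (by positivity)).2 fun t => ?_
  rw [pin_apply, pin_apply, dist_add_left, dist_eq_norm, ← sub_apply]
  exact (ContinuousLinearMap.le_opNorm _ _).trans
    (mul_le_mul_of_nonneg_right ((A - A').norm_coe_le_norm t) (norm_nonneg _))

lemma lipschitzWith_pin (hST : S < T)
    (p : EuclideanSpace ℝ (Fin d) × EuclideanSpace ℝ (Fin d)) :
    LipschitzWith (1 + ‖A‖₊) (pin A hST p) := by
  refine LipschitzWith.of_dist_le_mul fun g g' =>
    (ContinuousMap.dist_le (by positivity)).2 fun t => ?_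
  have e : pin A hST p g t - pin A hST p g' t =
      (g t - g' t) - A t (g (endTime hST) - g' (endTime hST)) := by
    simp only [pin_apply, map_sub]
    abel
  rw [dist_eq_norm, e]
  have h₁ : ‖g t - g' t‖ ≤ dist g g' := by
    rw [← dist_eq_norm]; exact ContinuousMap.dist_apply_le_dist t
  have h₂ : ‖g (endTime hST) - g' (endTime hST)‖ ≤ dist g g' := by
    rw [← dist_eq_norm]; exact ContinuousMap.dist_apply_le_dist _
  calc _ ≤ ‖g t - g' t‖ + ‖A t (g (endTime hST) - g' (endTime hST))‖ := norm_sub_le _ _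
    _ ≤ dist g g' + ‖A‖ * dist g g' := by
        refine add_le_add h₁ ((ContinuousLinearMap.le_opNorm _ _).trans ?_)
        exact mul_le_mul (A.norm_coe_le_norm t) h₂ (norm_nonneg _) (norm_nonneg A)
    _ = ((1 + ‖A‖₊ : ℝ≥0) : ℝ) * dist g g' := by push_cast; ring

end Pinning

section FixedEnvironment

variable {d : ℕ} {S T : ℝ} {hST : S < T} {m : Measure (EuclideanSpace ℝ (Fin d))}
  {Γ : ℝ → Matrix (Fin d) (Fin d) ℝ} {R : Measure (PathSpace S T d)} [IsProbabilityMeasure R]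
  {π : Measure (EuclideanSpace ℝ (Fin d) × EuclideanSpace ℝ (Fin d))} [IsProbabilityMeasure π]

/-- The projected law is the mixture over the endpoint law of the pinned Gaussian martingales. -/
lemma IsGaussianReference.changeMarginal_eq (hR : IsGaussianReference hST m Γ R)
    (hΓ : IsCumulant S T Γ) (hπ : π ≪ R.map (endpoints hST)) :
    changeMarginal R (endpoints hST) π =
      (π.prod R).map (fun q => pin hΓ.regression hST q.1 (centre hST q.2)) := by
  have hβ : Measurable fun x : PathSpace S T d => bridge hST hΓ.regression (centre hST x) :=
    ((continuous_bridge _ hST).comp (continuous_centre hST)).measurable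
  have := Measure.isProbabilityMeasure_map (μ := R) hβ.aemeasurable
  rw [changeMarginal_eq_map (continuous_endpoints hST).measurable hβ
    (continuous_assemble hΓ.regression).measurable (hR.indepFun_endpoints_bridge hΓ)
    (assemble_endpoints _ hST) hπ]
  have h : π.prod (R.map fun x => bridge hST hΓ.regression (centre hST x)) =
      (π.prod R).map (Prod.map id fun x => bridge hST hΓ.regression (centre hST x)) := by
    rw [← Measure.map_prod_map _ _ measurable_id hβ, Measure.map_id]
  rw [h, Measure.map_map (continuous_assemble hΓ.regression).measurable
    (measurable_id.prodMap hβ)]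
  rfl

/-- The entropy projection exists, is unique, and has an explicit density. -/
lemma IsGaussianReference.isEntropyProjection_iff (hR : IsGaussianReference hST m Γ R)
    (hΓ : IsCumulant S T Γ) (hent : InformationTheory.klDiv π (R.map (endpoints hST)) ≠ ∞)
    (P : ProbabilityMeasure (PathSpace S T d)) :
    IsEntropyProjection hST R π P ↔
      (P : Measure (PathSpace S T d)) = changeMarginal R (endpoints hST) π :=
  FrozenBridge.isEntropyProjection_iff hST (continuous_endpoints hST).measurable
    ((continuous_bridge hΓ.regression hST).comp (continuous_centre hST)).measurable
    (continuous_assemble hΓ.regression).measurable (hR.indepFun_endpoints_bridge hΓ)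
    (assemble_endpoints _ hST) hent P

/-- The projected laws converge if the cumulants and the regression coefficients do, while the
total covariance is kept. -/
theorem tendsto_integral_changeMarginal {Γn : ℕ → ℝ → Matrix (Fin d) (Fin d) ℝ}
    {Rn : ℕ → Measure (PathSpace S T d)} [∀ n, IsProbabilityMeasure (Rn n)]
    (hR : IsGaussianReference hST m Γ R) (hΓ : IsCumulant S T Γ)
    (hRn : ∀ n, IsGaussianReference hST m (Γn n) (Rn n)) (hΓn : ∀ n, IsCumulant S T (Γn n))
    (hT : ∀ n, Γn n T = Γ T)
    (hconv : ∀ t ∈ Set.Icc S T, Tendsto (fun n => Γn n t) atTop (𝓝 (Γ t)))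
    (hreg : Tendsto (fun n => ‖(hΓn n).regression - hΓ.regression‖) atTop (𝓝 0))
    (hπ : π ≪ R.map (endpoints hST))
    {F : PathSpace S T d → ℝ} {B : ℝ} {K : ℝ≥0} (hB : ∀ x y, dist (F x) (F y) ≤ B)
    (hK : LipschitzWith K F) :
    Tendsto (fun n => ∫ x, F x ∂(changeMarginal (Rn n) (endpoints hST) π)) atTop
      (𝓝 (∫ x, F x ∂(changeMarginal R (endpoints hST) π))) := by
  have hB0 : 0 ≤ B := dist_nonneg.trans (hB 0 0)
  set A := hΓ.regression
  have hends : ∀ n, (Rn n).map (endpoints hST) = R.map (endpoints hST) := fun n => by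
    rw [(hRn n).map_endpoints (hΓn n), hR.map_endpoints hΓ, hT n]
  have hbound : ∀ x, ‖F x‖ ≤ ‖F 0‖ + B := fun x =>
    calc ‖F x‖ = ‖F 0 + (F x - F 0)‖ := by congr 1; ring
      _ ≤ ‖F 0‖ + ‖F x - F 0‖ := norm_add_le _ _
      _ ≤ ‖F 0‖ + B := by gcongr; exact hB _ _
  have hpm : ∀ A' : C(Set.Icc S T, EuclideanSpace ℝ (Fin d) →L[ℝ] EuclideanSpace ℝ (Fin d)),
      Measurable fun q : (EuclideanSpace ℝ (Fin d) × EuclideanSpace ℝ (Fin d)) × PathSpace S T d =>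
        pin A' hST q.1 (centre hST q.2) := fun A' =>
    ((continuous_pin A' hST).comp
      (continuous_fst.prodMk ((continuous_centre hST).comp continuous_snd))).measurable
  have hint : ∀ (A' : C(Set.Icc S T, EuclideanSpace ℝ (Fin d) →L[ℝ] EuclideanSpace ℝ (Fin d)))
      (ν : Measure (PathSpace S T d)) [IsProbabilityMeasure ν],
      Integrable (fun q : (EuclideanSpace ℝ (Fin d) × EuclideanSpace ℝ (Fin d)) × PathSpace S T d =>
        F (pin A' hST q.1 (centre hST q.2))) (π.prod ν) := fun A' ν _ =>
    Integrable.of_bound (hK.continuous.measurable.comp (hpm A')).aestronglyMeasurable _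
      (ae_of_all _ fun q => hbound _)
  -- Averaging over the endpoints produces a bounded Lipschitz functional of the centred path.
  set H : PathSpace S T d → ℝ := fun g => ∫ p, F (pin A hST p g) ∂π with hH
  have hintp : ∀ g, Integrable (fun p => F (pin A hST p g)) π := fun g =>
    Integrable.of_bound (hK.continuous.comp ((continuous_pin A hST).comp
      (continuous_id.prodMk continuous_const))).measurable.aestronglyMeasurable _
      (ae_of_all _ fun p => hbound _)
  have hHB : ∀ g g', dist (H g) (H g') ≤ B := fun g g' => by
    rw [dist_eq_norm, hH, ← integral_sub (hintp g) (hintp g')]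
    have := norm_integral_le_of_norm_le_const (μ := π) (C := B)
      (f := fun p => F (pin A hST p g) - F (pin A hST p g')) (ae_of_all _ fun p => hB _ _)
    simpa using this
  have hHK : LipschitzWith (K * (1 + ‖A‖₊)) H := LipschitzWith.of_dist_le_mul fun g g' => by
    rw [dist_eq_norm, hH, ← integral_sub (hintp g) (hintp g')]
    have := norm_integral_le_of_norm_le_const (μ := π) (C := (K * (1 + ‖A‖₊) : ℝ≥0) * dist g g')
      (f := fun p => F (pin A hST p g) - F (pin A hST p g'))
      (ae_of_all _ fun p => (hK.comp (lipschitzWith_pin A hST p)).dist_le_mul g g')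
    simpa using this
  have hlim : Tendsto (fun n => ∫ q, F (pin A hST q.1 (centre hST q.2)) ∂(π.prod (Rn n))) atTop
      (𝓝 (∫ q, F (pin A hST q.1 (centre hST q.2)) ∂(π.prod R))) := by
    have hfub : ∀ (ν : Measure (PathSpace S T d)) [IsProbabilityMeasure ν],
        ∫ q, F (pin A hST q.1 (centre hST q.2)) ∂(π.prod ν) = ∫ x, H (centre hST x) ∂ν := by
      intro ν _
      exact integral_prod_symm _ (hint A ν)
    rw [hfub R]
    simp_rw [hfub (Rn _)]
    exact tendsto_integral_centre hR hΓ hRn hΓn hconv hHB hHK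
  -- The error made by exchanging the regression coefficients is controlled by the total increment,
  -- whose law is the same for all references.
  set C := multivariateGaussian (0 : EuclideanSpace ℝ (Fin d)) (Γ T) with hC
  set φ : ℕ → (EuclideanSpace ℝ (Fin d) × EuclideanSpace ℝ (Fin d)) × EuclideanSpace ℝ (Fin d) →
      ℝ := fun n q => min B (K * (‖(hΓn n).regression - A‖ * ‖q.1.2 - q.1.1 - q.2‖)) with hφ
  have hφc : ∀ n, Continuous (φ n) := fun n => by fun_prop
  have hφ0 : ∀ n q, 0 ≤ φ n q := fun n q => le_min hB0 (by positivity)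
  have hφlim : Tendsto (fun n => ∫ q, φ n q ∂(π.prod C)) atTop (𝓝 0) := by
    have := tendsto_integral_of_dominated_convergence (μ := π.prod C) (F := φ) (f := fun _ => 0)
      (fun _ => B) (fun n => (hφc n).measurable.aestronglyMeasurable) (integrable_const B)
      (fun n => ae_of_all _ fun q => by
        rw [Real.norm_of_nonneg (hφ0 n q)]; exact min_le_left _ _)
      (ae_of_all _ fun q => by
        have h := ((hreg.mul_const ‖q.1.2 - q.1.1 - q.2‖).const_mul (K : ℝ))
        have h' := (tendsto_const_nhds (x := B)).min h
        simpa [hB0] using h')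
    simpa using this
  have herr : ∀ n, ‖∫ q, F (pin (hΓn n).regression hST q.1 (centre hST q.2)) ∂(π.prod (Rn n)) -
      ∫ q, F (pin A hST q.1 (centre hST q.2)) ∂(π.prod (Rn n))‖ ≤ ∫ q, φ n q ∂(π.prod C) := by
    intro n
    have hcm : Measurable fun x : PathSpace S T d => centre hST x (endTime hST) :=
      (measurable_eval _).comp (continuous_centre hST).measurable
    have hmap : π.prod C =
        (π.prod (Rn n)).map (Prod.map id fun x => centre hST x (endTime hST)) := by
      rw [← Measure.map_prod_map _ _ measurable_id hcm, Measure.map_id,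
        (hRn n).map_centre_apply (hΓn n)]
      change π.prod C = π.prod (multivariateGaussian 0 (Γn n T))
      rw [hT n]
    rw [hmap, integral_map (measurable_id.prodMap hcm).aemeasurable
      (hφc n).measurable.aestronglyMeasurable, ← integral_sub (hint _ _) (hint _ _)]
    refine norm_integral_le_of_norm_le ?_ (ae_of_all _ fun q => ?_)
    · refine Integrable.of_bound ((hφc n).measurable.comp
        (measurable_id.prodMap hcm)).aestronglyMeasurable B (ae_of_all _ fun q => ?_)
      rw [Real.norm_of_nonneg (hφ0 n _)]
      exact min_le_left _ _
    · exact le_min (hB _ _) ((hK.dist_le_mul _ _).trans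
        (mul_le_mul_of_nonneg_left (dist_pin_pin_le _ _ hST _ _) K.2))
  rw [hR.changeMarginal_eq hΓ hπ, integral_map (hpm _).aemeasurable
    hK.continuous.measurable.aestronglyMeasurable]
  have hn : ∀ n, ∫ x, F x ∂(changeMarginal (Rn n) (endpoints hST) π) =
      ∫ q, F (pin (hΓn n).regression hST q.1 (centre hST q.2)) ∂(π.prod (Rn n)) := fun n => by
    rw [(hRn n).changeMarginal_eq (hΓn n) (by rw [hends n]; exact hπ),
      integral_map (hpm _).aemeasurable hK.continuous.measurable.aestronglyMeasurable]
  simp_rw [hn]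
  have := (squeeze_zero_norm herr hφlim).add hlim
  simpa using this

/-- The normalised interpolation error controls the cumulant. -/
lemma SubGrid.norm_sub_interpolate_le (P : SubGrid S T) (hST : S < T) (hΓ : IsCumulant S T Γ)
    {t : ℝ} (ht : t ∈ Set.Icc S T) :
    ‖Matrix.toEuclideanCLM (𝕜 := ℝ) (Γ t - P.interpolate Γ t)‖ ≤
      interpolationError P Γ * ‖Matrix.toEuclideanCLM (𝕜 := ℝ) (pinvSqrt (Γ T) * Γ T)‖ := by
  have h₂ := (P.isCumulant_interpolate hST hΓ).mul_pinv_mul ht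
  rw [P.interpolate_right hST] at h₂
  have e : Γ t - P.interpolate Γ t =
      (Γ t - P.interpolate Γ t) * pinvSqrt (Γ T) * (pinvSqrt (Γ T) * Γ T) := by
    conv_lhs => rw [← hΓ.mul_pinv_mul ht, ← h₂]
    rw [← sub_mul, pinv]
    simp only [mul_assoc]
  rw [e, map_mul]
  exact (norm_mul_le _ _).trans
    (mul_le_mul_of_nonneg_right (norm_le_interpolationError hST P hΓ ht) (norm_nonneg _))

/-- The normalised interpolation error controls the regression coefficients. -/
lemma SubGrid.norm_regression_sub_le (P : SubGrid S T) (hST : S < T) (hΓ : IsCumulant S T Γ) :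
    ‖(P.isCumulant_interpolate hST hΓ).regression - hΓ.regression‖ ≤
      interpolationError P Γ * ‖Matrix.toEuclideanCLM (𝕜 := ℝ) (pinvSqrt (Γ T))‖ := by
  have hη : 0 ≤ interpolationError P Γ :=
    (norm_nonneg _).trans (norm_le_interpolationError hST P hΓ (Set.left_mem_Icc.2 hST.le))
  refine (ContinuousMap.norm_le _ (by positivity)).2 fun t => ?_
  have e : (P.isCumulant_interpolate hST hΓ).regression t - hΓ.regression t =
      -Matrix.toEuclideanCLM (𝕜 := ℝ)
        ((Γ t - P.interpolate Γ t) * pinvSqrt (Γ T) * pinvSqrt (Γ T)) := by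
    rw [IsCumulant.regression_apply, IsCumulant.regression_apply, P.interpolate_right hST,
      mul_assoc, ← pinv, sub_mul, ← map_sub, ← map_neg, neg_sub]
  rw [ContinuousMap.sub_apply, e, norm_neg, map_mul]
  exact (norm_mul_le _ _).trans
    (mul_le_mul_of_nonneg_right (norm_le_interpolationError hST P hΓ t.2) (norm_nonneg _))

/-- Stability in a fixed environment: the projections of the piecewise-frozen references converge
weakly as soon as the normalised interpolation error tends to zero. -/
theorem tendsto_integral_changeMarginal_interpolate {P : ℕ → SubGrid S T}
    {Rn : ℕ → Measure (PathSpace S T d)} [∀ n, IsProbabilityMeasure (Rn n)]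
    (hR : IsGaussianReference hST m Γ R) (hΓ : IsCumulant S T Γ)
    (hRn : ∀ n, IsGaussianReference hST m ((P n).interpolate Γ) (Rn n))
    (hη : Tendsto (fun n => interpolationError (P n) Γ) atTop (𝓝 0))
    (hπ : π ≪ R.map (endpoints hST))
    {F : PathSpace S T d → ℝ} {B : ℝ} {K : ℝ≥0} (hB : ∀ x y, dist (F x) (F y) ≤ B)
    (hK : LipschitzWith K F) :
    Tendsto (fun n => ∫ x, F x ∂(changeMarginal (Rn n) (endpoints hST) π)) atTop
      (𝓝 (∫ x, F x ∂(changeMarginal R (endpoints hST) π))) := by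
  refine tendsto_integral_changeMarginal hR hΓ hRn
    (fun n => (P n).isCumulant_interpolate hST hΓ) (fun n => (P n).interpolate_right hST Γ)
    (fun t ht => ?_) ?_ hπ hB hK
  · have hc : Continuous (Matrix.toEuclideanCLM (n := Fin d) (𝕜 := ℝ)).symm :=
      LinearMap.continuous_of_finiteDimensional
        (Matrix.toEuclideanCLM (n := Fin d) (𝕜 := ℝ)).symm.toAlgEquiv.toLinearMap
    have h : Tendsto (fun n => Matrix.toEuclideanCLM (𝕜 := ℝ) (Γ t - (P n).interpolate Γ t)) atTop
        (𝓝 0) := squeeze_zero_norm (fun n => (P n).norm_sub_interpolate_le hST hΓ ht)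
          (by simpa using hη.mul_const _)
    have h' := (hc.tendsto 0).comp h
    simp only [Function.comp_def, StarAlgEquiv.symm_apply_apply, map_zero] at h'
    have h'' := (tendsto_const_nhds (x := Γ t)).sub h'
    simpa using h''
  · exact squeeze_zero (fun n => norm_nonneg (((P n).isCumulant_interpolate hST hΓ).regression -
      hΓ.regression)) (fun n => (P n).norm_regression_sub_le hST hΓ)
      (by simpa using hη.mul_const _)

end FixedEnvironment

/-! ### Convergence in probability -/

/-- The law with changed marginal depends measurably on the environment. -/
lemma exists_kernel_eq_changeMarginal {Y X V : Type*} [MeasurableSpace Y] [MeasurableSpace X]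
    [MeasurableSpace V] [MeasurableSpace.CountableOrCountablyGenerated Y V]
    (R : Kernel Y X) [IsMarkovKernel R] {e : X → V} (he : Measurable e) (π : Kernel Y V)
    [IsMarkovKernel π] : ∃ κ : Kernel Y X, ∀ y, κ y = changeMarginal (R y) e (π y) := by
  have := Kernel.IsMarkovKernel.map R he
  have hm : Measurable (Function.uncurry fun (y : Y) (x : X) =>
      Kernel.rnDeriv π (R.map e) y (e x)) :=
    (Kernel.measurable_rnDeriv π (R.map e)).comp
      (measurable_fst.prodMk (he.comp measurable_snd))
  refine ⟨Kernel.withDensity R fun y x => Kernel.rnDeriv π (R.map e) y (e x), fun y => ?_⟩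
  rw [Kernel.withDensity_apply R hm, changeMarginal]
  refine withDensity_congr_ae ?_
  have h := Kernel.rnDeriv_eq_rnDeriv_measure (κ := π) (η := R.map e) (a := y)
  rw [Kernel.map_apply R he] at h
  exact ae_of_ae_map he.aemeasurable h

/-- The Lévy–Prokhorov form of the stability in a fixed environment. -/
theorem tendsto_levyProkhorovEDist_changeMarginal {d : ℕ} {S T : ℝ} {hST : S < T}
    {m : Measure (EuclideanSpace ℝ (Fin d))} {Γ : ℝ → Matrix (Fin d) (Fin d) ℝ}
    {R : Measure (PathSpace S T d)} [IsProbabilityMeasure R]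
    {π : Measure (EuclideanSpace ℝ (Fin d) × EuclideanSpace ℝ (Fin d))} [IsProbabilityMeasure π]
    {P : ℕ → SubGrid S T} {Rn : ℕ → Measure (PathSpace S T d)} [∀ n, IsProbabilityMeasure (Rn n)]
    (hR : IsGaussianReference hST m Γ R) (hΓ : IsCumulant S T Γ)
    (hRn : ∀ n, IsGaussianReference hST m ((P n).interpolate Γ) (Rn n))
    (hη : Tendsto (fun n => interpolationError (P n) Γ) atTop (𝓝 0))
    (hπ : π ≪ R.map (endpoints hST)) :
    Tendsto (fun n => levyProkhorovEDist (changeMarginal (Rn n) (endpoints hST) π)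
      (changeMarginal R (endpoints hST) π)) atTop (𝓝 0) := by
  have he := (continuous_endpoints (d := d) hST).measurable
  have hπn : ∀ n, π ≪ (Rn n).map (endpoints hST) := fun n => by
    rwa [(hRn n).map_endpoints ((P n).isCumulant_interpolate hST hΓ),
      (P n).interpolate_right hST, ← hR.map_endpoints hΓ]
  let ρ : ProbabilityMeasure (PathSpace S T d) :=
    ⟨changeMarginal R (endpoints hST) π, isProbabilityMeasure_changeMarginal he hπ⟩
  let ρn : ℕ → ProbabilityMeasure (PathSpace S T d) := fun n =>
    ⟨changeMarginal (Rn n) (endpoints hST) π, isProbabilityMeasure_changeMarginal he (hπn n)⟩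
  have hweak : Tendsto ρn atTop (𝓝 ρ) :=
    tendsto_iff_forall_lipschitz_integral_tendsto.2 fun F ⟨B, hB⟩ ⟨K, hK⟩ =>
      tendsto_integral_changeMarginal_interpolate hR hΓ hRn hη hπ hB hK
  have h := (LevyProkhorov.continuous_ofMeasure_probabilityMeasure.tendsto ρ).comp hweak
  exact tendsto_iff_edist_tendsto_0.1 h

end FrozenBridge

theorem mainTheorem5 {d : ℕ} {S T : ℝ} (hST : S < T)
    -- the history `h` and the latent environment `Y` take values in `H` and `L`; `Q` is the law of
    -- `(h, Y)`
    {H L : Type*} [MeasurableSpace H] [MeasurableSpace L]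
    (Q : Measure (H × L)) [IsProbabilityMeasure Q]
    -- the volatility `σ(t, h, Y)`, with integrable covariance `a = σ σᵀ`
    (σ : ℝ → H × L → Matrix (Fin d) (Fin d) ℝ)
    (hσ : ∀ᵐ y ∂Q, ∀ i j,
      IntervalIntegrable (fun t => (σ t y * (σ t y).transpose) i j) volume S T)
    -- the conditional law of the starting point, and the conditional endpoint law `π^{h,Y}`
    (m : Kernel (H × L) (EuclideanSpace ℝ (Fin d))) [IsMarkovKernel m]
    (π : Kernel (H × L) (EuclideanSpace ℝ (Fin d) × EuclideanSpace ℝ (Fin d))) [IsMarkovKernel π]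
    -- the ideal reference, conditionally Gaussian
    (R : Kernel (H × L) (FrozenBridge.PathSpace S T d)) [IsMarkovKernel R]
    (hR : ∀ᵐ y ∂Q, FrozenBridge.IsGaussianReference hST (m y)
      (FrozenBridge.cumulant S fun t => σ t y) (R y))
    -- the piecewise-frozen references along the grids `P n`
    (P : ℕ → FrozenBridge.SubGrid S T)
    (RP : ℕ → Kernel (H × L) (FrozenBridge.PathSpace S T d)) [∀ n, IsMarkovKernel (RP n)]
    (hRP : ∀ n, ∀ᵐ y ∂Q, FrozenBridge.IsGaussianReference hST (m y)
      ((P n).interpolate (FrozenBridge.cumulant S fun t => σ t y)) (RP n y))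
    -- finite entropy of the endpoint law relative to that of the reference
    (hent : ∀ᵐ y ∂Q, InformationTheory.klDiv (π y)
      ((R y).map (FrozenBridge.endpoints hST)) ≠ ∞)
    -- the cumulant interpolation error tends to zero in probability
    (hη : TendstoInMeasure Q
      (fun n y => FrozenBridge.interpolationError (P n) (FrozenBridge.cumulant S fun t => σ t y))
      atTop (fun _ => (0 : ℝ)))
    -- the intrinsic endpoint norms are tight under the endpoint laws
    (htight : ∀ ε : ℝ≥0∞, 0 < ε → ∃ K : ℝ,
      ∫⁻ y, π y {p | K < FrozenBridge.endpointNorm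
        (FrozenBridge.cumulant S (fun t => σ t y) T) p} ∂Q ≤ ε) :
    -- the entropy projections exist and are unique, almost surely
    (∀ᵐ y ∂Q, ∃! A, FrozenBridge.IsEntropyProjection hST (R y) (π y) A) ∧
    (∀ n, ∀ᵐ y ∂Q, ∃! A, FrozenBridge.IsEntropyProjection hST (RP n y) (π y) A) ∧
    -- convergence in probability for the Lévy-Prokhorov metric, which metrises weak convergence
    TendstoInMeasure Q
      (fun n y => LevyProkhorov.ofMeasure
        (FrozenBridge.entropyProjection hST (RP n y) (π y)))
      atTop
      (fun y => LevyProkhorov.ofMeasure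
        (FrozenBridge.entropyProjection hST (R y) (π y))) := by
  have he := (FrozenBridge.continuous_endpoints (d := d) hST).measurable
  have hΓ : ∀ᵐ y ∂Q, FrozenBridge.IsCumulant S T (FrozenBridge.cumulant S fun t => σ t y) := by
    filter_upwards [hσ] with y hy using FrozenBridge.isCumulant_cumulant hST hy
  -- The frozen references have the endpoint law of the ideal one, hence the same finite entropy.
  have hentP : ∀ n, ∀ᵐ y ∂Q, InformationTheory.klDiv (π y)
      ((RP n y).map (FrozenBridge.endpoints hST)) ≠ ∞ := fun n => by
    filter_upwards [hΓ, hR, hRP n, hent] with y hΓy hRy hRPy hy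
    rwa [hRPy.map_endpoints ((P n).isCumulant_interpolate hST hΓy), (P n).interpolate_right hST,
      ← hRy.map_endpoints hΓy]
  have hiff : ∀ᵐ y ∂Q, ∀ A, FrozenBridge.IsEntropyProjection hST (R y) (π y) A ↔
      (A : Measure (FrozenBridge.PathSpace S T d)) =
        FrozenBridge.changeMarginal (R y) (FrozenBridge.endpoints hST) (π y) := by
    filter_upwards [hΓ, hR, hent] with y hΓy hRy hy using hRy.isEntropyProjection_iff hΓy hy
  have hiffP : ∀ n, ∀ᵐ y ∂Q, ∀ A, FrozenBridge.IsEntropyProjection hST (RP n y) (π y) A ↔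
      (A : Measure (FrozenBridge.PathSpace S T d)) =
        FrozenBridge.changeMarginal (RP n y) (FrozenBridge.endpoints hST) (π y) := fun n => by
    filter_upwards [hΓ, hRP n, hentP n] with y hΓy hRy hy using
      hRy.isEntropyProjection_iff ((P n).isCumulant_interpolate hST hΓy) hy
  have hprob : ∀ᵐ y ∂Q, IsProbabilityMeasure
      (FrozenBridge.changeMarginal (R y) (FrozenBridge.endpoints hST) (π y)) := by
    filter_upwards [hent] with y hy using FrozenBridge.isProbabilityMeasure_changeMarginal he
      (InformationTheory.klDiv_ne_top_iff.1 hy).1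
  have hprobP : ∀ n, ∀ᵐ y ∂Q, IsProbabilityMeasure
      (FrozenBridge.changeMarginal (RP n y) (FrozenBridge.endpoints hST) (π y)) := fun n => by
    filter_upwards [hentP n] with y hy using FrozenBridge.isProbabilityMeasure_changeMarginal he
      (InformationTheory.klDiv_ne_top_iff.1 hy).1
  have hex : ∀ᵐ y ∂Q, ∃! A, FrozenBridge.IsEntropyProjection hST (R y) (π y) A := by
    filter_upwards [hiff, hprob] with y hy hpy
    exact ⟨⟨_, hpy⟩, (hy _).2 rfl, fun A hA => Subtype.ext ((hy A).1 hA)⟩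
  have hexP : ∀ n, ∀ᵐ y ∂Q, ∃! A, FrozenBridge.IsEntropyProjection hST (RP n y) (π y) A := by
    intro n
    filter_upwards [hiffP n, hprobP n] with y hy hpy
    exact ⟨⟨_, hpy⟩, (hy _).2 rfl, fun A hA => Subtype.ext ((hy A).1 hA)⟩
  refine ⟨hex, hexP, ?_⟩
  obtain ⟨κ, hκ⟩ := FrozenBridge.exists_kernel_eq_changeMarginal R he π
  choose κn hκn using fun n => FrozenBridge.exists_kernel_eq_changeMarginal (RP n) he π
  -- The distance of the projections agrees almost surely with the measurable function `D n`.
  set D : ℕ → H × L → ℝ := fun n y => (levyProkhorovEDist (κn n y) (κ y)).toReal with hD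
  have hDm : ∀ n, Measurable (D n) := fun n =>
    (FrozenBridge.measurable_levyProkhorovEDist (κn n) κ).ennreal_toReal
  have hDeq : ∀ n, ∀ᵐ y ∂Q, edist
      (LevyProkhorov.ofMeasure (FrozenBridge.entropyProjection hST (RP n y) (π y)))
      (LevyProkhorov.ofMeasure (FrozenBridge.entropyProjection hST (R y) (π y))) =
      edist (D n y) 0 := fun n => by
    filter_upwards [hiff, hiffP n, hex, hexP n] with y hy hyP hey heyP
    have h₁ := (hy _).1 (Classical.epsilon_spec hey.exists)
    have h₂ := (hyP _).1 (Classical.epsilon_spec heyP.exists)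
    rw [← hκ y] at h₁
    rw [← hκn n y] at h₂
    rw [LevyProkhorov.edist_probabilityMeasure_def]
    change levyProkhorovEDist
      (FrozenBridge.entropyProjection hST (RP n y) (π y) : Measure (FrozenBridge.PathSpace S T d))
      (FrozenBridge.entropyProjection hST (R y) (π y) : Measure (FrozenBridge.PathSpace S T d)) = _
    have hfin := levyProkhorovEDist_lt_top
      (FrozenBridge.entropyProjection hST (RP n y) (π y) : Measure (FrozenBridge.PathSpace S T d))
      (FrozenBridge.entropyProjection hST (R y) (π y) : Measure (FrozenBridge.PathSpace S T d))
    have e₁ : (FrozenBridge.entropyProjection hST (R y) (π y) :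
      Measure (FrozenBridge.PathSpace S T d)) = κ y := h₁
    have e₂ : (FrozenBridge.entropyProjection hST (RP n y) (π y) :
      Measure (FrozenBridge.PathSpace S T d)) = κn n y := h₂
    rw [e₁, e₂] at hfin ⊢
    rw [edist_dist, Real.dist_0_eq_abs, abs_of_nonneg ENNReal.toReal_nonneg,
      ENNReal.ofReal_toReal hfin.ne]
  -- Along subsequences with almost surely vanishing interpolation error, the stability in a fixed
  -- environment applies.
  have hDlim : TendstoInMeasure Q D atTop fun _ => 0 := by
    refine (exists_seq_tendstoInMeasure_atTop_iff
      fun n => (hDm n).aestronglyMeasurable).2 fun ns hns => ?_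
    obtain ⟨ns', hns', hlim⟩ := (hη.comp hns.tendsto_atTop).exists_seq_tendsto_ae
    refine ⟨ns', hns', ?_⟩
    filter_upwards [hlim, hΓ, hR, ae_all_iff.2 hRP, hent] with y hy hΓy hRy hRPy henty
    have h := FrozenBridge.tendsto_levyProkhorovEDist_changeMarginal
      (P := fun k => P (ns (ns' k))) (Rn := fun k => RP (ns (ns' k)) y) hRy hΓy
      (fun k => hRPy _) hy (InformationTheory.klDiv_ne_top_iff.1 henty).1
    simp_rw [← hκn, ← hκ] at h
    have h' := (ENNReal.tendsto_toReal ENNReal.zero_ne_top).comp h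
    rwa [ENNReal.toReal_zero] at h'
  intro ε hε
  refine (hDlim ε hε).congr fun n => measure_congr (Filter.eventuallyEq_set.2 ?_)
  filter_upwards [hDeq n] with y hy
  rw [hy]
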